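/- Let $V$ be a model of $\mathsf{ZF}$ and let $\mathcal A=(A,B,\prec,\bot\!\!\!\bot)$ be a realizability algebra in $V$: $A$ and $B\ne\emptyset$ are sets of $V$ (indexing the special instructions and the stack bottoms); $\Lambda$, $\Pi$ and $\mathcal R$ denote the sets, in the sense of $V$, of closed $\lambda_c$-terms, of stacks, and of realizers (closed $\lambda_c$-terms without continuation constants $k_\pi$); $\prec\,\in V$ is a preorder on $\Lambda\times\Pi$ with $ts\star\pi\succ t\star s\cdot\pi$, $\ \lambda u.t\star s\cdot\pi\succ t[u:=s]\star\pi$, $\ \mathsf{cc}\star t\cdot\pi\succ t\star k_\pi\cdot\pi$, $\ k_\sigma\star t\cdot\pi\succ t\star\sigma$; and the pole $\bot\!\!\!\bot\in V$ is a subset of $\Lambda\times\Pi$ such that $p\succ q\in\bot\!\!\!\bot$ implies $p\in\bot\!\!\!\bot$. The class $N\subseteq V$ of names is $\bigcup_{\alpha}N_\alpha$, $N_\alpha=\bigcup_{\beta<\alpha}\mathcal P(N_\beta\times\Pi)$. For formulas with parameters in $N$, the falsity values $\|\varphi\|\subseteq\Pi$ and the truth values $|\varphi|=\{t\in\Lambda:\forall\pi\in\|\varphi\|,\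 t\star\pi\in\bot\!\!\!\bot\}$ are given by $\|\top\|=\emptyset$, $\|\bot\|=\Pi$, $\|a\not\mathrel\varepsilon b\|=\{\pi:(a,\pi)\in b\}$, $\|a\ne b\|=\emptyset$ if $a\neq b$ and $\Pi$ otherwise, $\|a\notin b\|=\{t\cdot t'\cdot\pi:(c,\pi)\in b,\ t\in|a\subseteq c|,\ t'\in|c\subseteq a|\}$, $\|a\subseteq b\|=\{t\cdot\pi:(c,\pi)\in a,\ t\in|c\notin b|\}$, $\|\psi\to\theta\|=\{t\cdot\pi:t\in|\psi|,\ \pi\in\|\theta\|\}$, $\|\forall x\,\varphi(x)\|=\bigcup_{a\in N}\|\varphi(a)\|$. For a class $X$ of pairs of a name and a stack, $\|a\not\mathrel\varepsilon X\|$, $\|a\notin X\|$, $\|a\subseteq X\|$ are defined by the same clauses, and $\|\forall x^{X}\varphi(x)\|=\bigcup\{\|\varphi(a)\|:\exists\pi\,(a,\pi)\in X\}$. The connectives $\wedge,\exists$ and $\varepsilon$, $\in$ are the usual abbreviations, with $\neg\varphi$ being $\varphi\to\bot$. Write $t\Vdash\varphi$ for $t\in|\varphi|$, and $\mathcal N\Vdash\varphi$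 if some $t\in\mathcal R$ realizes the closed formula $\varphi$. For $x\in V$ let recursively $\mathrm{reish}(x)=\{(\mathrm{reish}(y),\pi):y\in x,\ \pi\in\Pi\}$, and let $\mathrm{R}=\{(\mathrm{reish}(\alpha),\pi):\alpha\in\mathrm{Ord}^V,\ \pi\in\Pi\}$. Let $\mathrm{Ord}_\in(x)$ say that $x$ is an $\in$-transitive set of $\in$-transitive sets, where $x$ is $\in$-transitive if $\forall y\in x\,\forall z\in y\,(z\in x)$; and let $\mathrm{Ord}_\varepsilon(x)$ be the same with $\varepsilon$ in place of $\in$. Then $\mathrm R$ is a name for the class of all extensional ordinals: 1. $\mathcal N\Vdash\forall x\,(\mathrm{Ord}_\in(x)\to x\in\mathrm R)$ and $\mathcal N\Vdash\forall x\,(x\in\mathrm R\to\mathrm{Ord}_\in(x))$. 2. $\mathcal N\Vdash\forall x^{\mathrm R}\,\mathrm{Ord}_\varepsilon(x)$. 3. $\mathrm R$ is closed under initial segments: $\mathcal N\Vdash\forall x^{\mathrm R}(x\subseteq\mathrm R)$ and $\mathcal N\Vdash\forall x\,(x\in\mathrm R\to\forall y\,(y\in x\to y\in\mathrm R))$. 4.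 $\mathrm R$ is a proper class: $\mathcal N\Vdash\forall x\,\exists y\,(y\mathrel\varepsilon\mathrm R\wedge y\notin x)$; moreover there is one $t\in\mathcal R$ such that for every $a\in N$ there is an ordinal $\beta$ of $V$ with $t\Vdash\mathrm{reish}(\beta)\notin a$. -/

import Mathlib

namespace Krivine

/-! ## Models of ZF -/

/-- The only symbol of the language of set theory: binary membership. -/
inductive MemSymb : ℕ → Type
  | mem : MemSymb 2

/-- The first-order language of set theory. -/
def setLang : FirstOrder.Language.{0, 0} := ⟨fun _ => Empty, MemSymb⟩

/-- Membership in a structure for the language of set theory. -/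
def Mem {V : Type*} [setLang.Structure V] (x y : V) : Prop :=
  FirstOrder.Language.Structure.RelMap (L := setLang) (n := 2) MemSymb.mem ![x, y]

infix:50 " ∊ " => Krivine.Mem

/-- `V` is a (not necessarily standard) model of Zermelo-Fraenkel set theory without choice. The
schemas are stated for the subsets of `V` and `V × V` that are first-order definable with
parameters. -/
class ModelZF (V : Type*) [setLang.Structure V] : Prop where
  extensionality : ∀ a b : V, (∀ x, x ∊ a ↔ x ∊ b) → a = b
  foundation : ∀ a : V, (∃ x, x ∊ a) → ∃ x, x ∊ a ∧ ∀ y, y ∊ x → ¬ y ∊ a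
  pairing : ∀ a b : V, ∃ c, ∀ x, x ∊ c ↔ x = a ∨ x = b
  union : ∀ a : V, ∃ c, ∀ x, x ∊ c ↔ ∃ y, y ∊ a ∧ x ∊ y
  powerset : ∀ a : V, ∃ c, ∀ x, x ∊ c ↔ ∀ y, y ∊ x → y ∊ a
  infinity : ∃ w : V, (∃ e, e ∊ w ∧ ∀ x, ¬ x ∊ e) ∧
    ∀ x, x ∊ w → ∃ y, y ∊ w ∧ ∀ z, z ∊ y ↔ z ∊ x ∨ z = x
  separation : ∀ P : Set V, (Set.univ : Set V).Definable₁ setLang P →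
    ∀ a : V, ∃ c, ∀ x, x ∊ c ↔ x ∊ a ∧ x ∈ P
  replacement : ∀ F : V → V → Prop,
    (Set.univ : Set V).Definable₂ setLang (Function.uncurry F) →
    ∀ a : V, (∀ x, x ∊ a → ∀ y z, F x y → F x z → y = z) →
      ∃ c, ∀ y, y ∊ c ↔ ∃ x, x ∊ a ∧ F x y

section Basic

variable {V : Type*} [setLang.Structure V] [ModelZF V]

theorem exists_empty : ∃ e : V, ∀ x, ¬ x ∊ e := by
  obtain ⟨_, ⟨e, _, he⟩, _⟩ := ModelZF.infinity (V := V)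
  exact ⟨e, he⟩

/-- The empty set of `V`. -/
noncomputable def empty : V := Classical.choose (exists_empty (V := V))

/-- The unordered pair `{a, b}` of `V`. -/
noncomputable def upair (a b : V) : V := Classical.choose (ModelZF.pairing a b)

/-- The union `⋃ a` of `V`. -/
noncomputable def sUnion (a : V) : V := Classical.choose (ModelZF.union a)

theorem not_mem_empty (x : V) : ¬ x ∊ (empty : V) :=
  Classical.choose_spec (exists_empty (V := V)) x

theorem mem_upair (a b x : V) : x ∊ upair a b ↔ x = a ∨ x = b :=
  Classical.choose_spec (ModelZF.pairing a b) x

theorem mem_sUnion (a x : V) : x ∊ sUnion a ↔ ∃ y, y ∊ a ∧ x ∊ y :=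
  Classical.choose_spec (ModelZF.union a) x

/-- The Kuratowski pair `(a, b) = {{a}, {a, b}}` of `V`. -/
noncomputable def pair (a b : V) : V := upair (upair a a) (upair a b)

/-- The successor `a ∪ {a}`. -/
noncomputable def succ (a : V) : V := sUnion (upair a (upair a a))

theorem mem_succ (a x : V) : x ∊ succ a ↔ x ∊ a ∨ x = a := by
  simp [succ, mem_sUnion, mem_upair]

theorem pair_inj {a b c d : V} (h : pair a b = pair c d) : a = c ∧ b = d := by
  have key : ∀ a b x : V, x ∊ pair a b ↔ x = upair a a ∨ x = upair a b :=
    fun a b x => mem_upair _ _ x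
  have e1 : ∀ u v w : V, upair u u = upair v w → u = v ∧ u = w := fun u v w huv =>
    ⟨by simpa [mem_upair, eq_comm] using congrArg (v ∊ ·) huv,
     by simpa [mem_upair, eq_comm] using congrArg (w ∊ ·) huv⟩
  have hac : a = c := by
    have h1 : upair a a ∊ pair c d := h ▸ (key a b _).2 (Or.inl rfl)
    rcases (key c d _).1 h1 with h2 | h2
    · exact (e1 _ _ _ h2).1
    · exact (e1 _ _ _ h2).1
  subst hac
  refine ⟨rfl, ?_⟩
  have h1 : upair a b ∊ pair a d := h ▸ (key a b _).2 (Or.inr rfl)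
  have h2 : upair a d ∊ pair a b := h.symm ▸ (key a d _).2 (Or.inr rfl)
  rcases (key a d _).1 h1 with h3 | h3
  · have hb := (e1 _ _ _ h3.symm).2
    subst hb
    rcases (key a a _).1 h2 with h4 | h4
    · exact (e1 _ _ _ h4.symm).2
    · exact (e1 _ _ _ h4.symm).2
  · have hb : b ∊ upair a d := h3 ▸ (mem_upair a b b).2 (Or.inr rfl)
    have hd : d ∊ upair a b := h3.symm ▸ (mem_upair a d d).2 (Or.inr rfl)
    rcases (mem_upair _ _ _).1 hb with h4 | h4
    · rcases (mem_upair _ _ _).1 hd with h5 | h5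
      · rw [h4, h5]
      · exact h5.symm
    · exact h4

/-- The standard numerals of `V`, used as tags only. -/
noncomputable def num : ℕ → V
  | 0 => empty
  | n + 1 => succ (num n)

/-- `n` is a natural number of `V`: it lies in every inductive set of `V`. -/
def IsNat (n : V) : Prop :=
  ∀ S : V, empty ∊ S → (∀ x, x ∊ S → succ x ∊ S) → n ∊ S

def IsTransitive (a : V) : Prop := ∀ x, x ∊ a → ∀ y, y ∊ x → y ∊ a

/-- The ordinals of `V` (von Neumann; `V` satisfies foundation). -/
def IsOrd (a : V) : Prop := IsTransitive a ∧ ∀ x, x ∊ a → IsTransitive x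

/-! ## The terms and stacks of the `λ_c`-calculus, inside `V`

Terms up to `α`-equivalence are coded with de Bruijn indices. As `V` may have nonstandard natural
numbers, the grammars are read inside `V`: being generated by rules means belonging to every set of
`V` that is closed under the rules. -/

/-- The variable with de Bruijn index `i`. -/
noncomputable def tVar (i : V) : V := pair (num 0) i
/-- Application `t s`. -/
noncomputable def tApp (t s : V) : V := pair (num 1) (pair t s)
/-- Abstraction; it binds the index `0` of `t`. -/
noncomputable def tLam (t : V) : V := pair (num 2) t
/-- Call-with-current-continuation. -/
noncomputable def tCC : V := pair (num 3) empty
/-- The continuation constant of the stack `π`. -/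
noncomputable def tCont (π : V) : V := pair (num 4) π
/-- The special instruction with index `α`. -/
noncomputable def tInstr (α : V) : V := pair (num 5) α
/-- The stack bottom with index `β`. -/
noncomputable def sBot (β : V) : V := pair (num 6) β
/-- The stack `t · π`. -/
noncomputable def push (t π : V) : V := pair (num 7) (pair t π)
/-- The process `t ⋆ π`. -/
noncomputable def proc (t π : V) : V := pair t π

/-- The sets `S` and `P` of `V` are closed under the grammars of terms and stacks, where
`(n, t)` in `S` stands for "`t` is a term whose free variables have indices below `n`" and `π` in
`P` for "`π` is a stack". -/
structure GrammarClosed (A B S P : V) : Prop where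
  var : ∀ n i, IsNat n → i ∊ n → pair n (tVar i) ∊ S
  app : ∀ n t s, pair n t ∊ S → pair n s ∊ S → pair n (tApp t s) ∊ S
  lam : ∀ n t, IsNat n → pair (succ n) t ∊ S → pair n (tLam t) ∊ S
  cc : ∀ n, IsNat n → pair n tCC ∊ S
  cont : ∀ n π, IsNat n → π ∊ P → pair n (tCont π) ∊ S
  instr : ∀ n α, IsNat n → α ∊ A → pair n (tInstr α) ∊ S
  bot : ∀ β, β ∊ B → sBot β ∊ P
  push : ∀ t π, pair empty t ∊ S → π ∊ P → push t π ∊ P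

/-- `t` is a `λ_c`-term whose free variables have indices below `n`. -/
def IsTerm (A B n t : V) : Prop := ∀ S P : V, GrammarClosed A B S P → pair n t ∊ S

/-- `t ∈ Λ`: `t` is a closed `λ_c`-term. -/
def IsClosedTerm (A B t : V) : Prop := IsTerm A B empty t

/-- `π ∈ Π`: `π` is a stack. -/
def IsStack (A B π : V) : Prop := ∀ S P : V, GrammarClosed A B S P → π ∊ P

/-- `S` is closed under the grammar of the terms without continuation constants. -/
structure ContFreeClosed (A S : V) : Prop where
  var : ∀ n i, IsNat n → i ∊ n → pair n (tVar i) ∊ S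
  app : ∀ n t s, pair n t ∊ S → pair n s ∊ S → pair n (tApp t s) ∊ S
  lam : ∀ n t, IsNat n → pair (succ n) t ∊ S → pair n (tLam t) ∊ S
  cc : ∀ n, IsNat n → pair n tCC ∊ S
  instr : ∀ n α, IsNat n → α ∊ A → pair n (tInstr α) ∊ S

/-- `t ∈ 𝓡`: `t` is a closed term in which no continuation constant occurs. -/
def IsRealizer (A t : V) : Prop := ∀ S : V, ContFreeClosed A S → pair empty t ∊ S

/-- `S` is closed under the rules that compute the substitution of the closed term `s`, where
`(k, (t, r))` in `S` stands for "`r` is `t` with `s` in place of the variable with index `k`" (`t`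
having its free variables below `k + 1`). No shifting is needed, as `s` is closed. -/
structure SubstClosed (A B s S : V) : Prop where
  var_lt : ∀ k i, IsNat k → i ∊ k → pair k (pair (tVar i) (tVar i)) ∊ S
  var_eq : ∀ k, IsNat k → pair k (pair (tVar k) s) ∊ S
  app : ∀ k t t' r r', pair k (pair t r) ∊ S → pair k (pair t' r') ∊ S →
    pair k (pair (tApp t t') (tApp r r')) ∊ S
  lam : ∀ k t r, IsNat k → pair (succ k) (pair t r) ∊ S → pair k (pair (tLam t) (tLam r)) ∊ S
  cc : ∀ k, IsNat k → pair k (pair tCC tCC) ∊ S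
  cont : ∀ k π, IsNat k → IsStack A B π → pair k (pair (tCont π) (tCont π)) ∊ S
  instr : ∀ k α, IsNat k → α ∊ A → pair k (pair (tInstr α) (tInstr α)) ∊ S

/-- `r = t[u := s]`, where `u` is the variable with index `0` in `t`, the only one free in it. -/
def IsSubst (A B t s r : V) : Prop :=
  ∀ S : V, SubstClosed A B s S → pair empty (pair t r) ∊ S

/-- The rules of evaluation: `EvalStep A B p q` means `p ≻ q` by one of the four rules. -/
inductive EvalStep (A B : V) : V → V → Prop
  | push (t s π : V) : IsClosedTerm A B t → IsClosedTerm A B s → IsStack A B π →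
      EvalStep A B (proc (tApp t s) π) (proc t (push s π))
  | grab (t s r π : V) : IsTerm A B (succ empty) t → IsClosedTerm A B s → IsStack A B π →
      IsSubst A B t s r → EvalStep A B (proc (tLam t) (push s π)) (proc r π)
  | save (t π : V) : IsClosedTerm A B t → IsStack A B π →
      EvalStep A B (proc tCC (push t π)) (proc t (push (tCont π) π))
  | restore (t σ π : V) : IsClosedTerm A B t → IsStack A B σ → IsStack A B π →
      EvalStep A B (proc (tCont σ) (push t π)) (proc t σ)

/-- `p` is a process, that is, an element of `Λ ⋆ Π`. -/
def IsProc (A B p : V) : Prop := ∃ t π, IsClosedTerm A B t ∧ IsStack A B π ∧ p = proc t π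

end Basic

/-! ## Realizability algebras -/

/-- A realizability algebra in `V`. All its data are elements of `V`. The pair `(q, p)` belongs to
`prec` when `q ≺ p`, that is, `p ≻ q`. A preorder on the processes extends the evaluation preorder
(the smallest one that contains the four rules) exactly if it contains the four rules. -/
structure RealizabilityAlgebra (V : Type*) [setLang.Structure V] [ModelZF V] where
  A : V
  B : V
  B_nonempty : ∃ β, β ∊ B
  prec : V
  prec_rel : ∀ x, x ∊ prec → ∃ p q, IsProc A B p ∧ IsProc A B q ∧ x = pair q p
  prec_refl : ∀ p, IsProc A B p → pair p p ∊ prec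
  prec_trans : ∀ p q r, pair r q ∊ prec → pair q p ∊ prec → pair r p ∊ prec
  prec_eval : ∀ p q, EvalStep A B p q → pair q p ∊ prec
  pole : V
  pole_sub : ∀ p, p ∊ pole → IsProc A B p
  pole_closed : ∀ p q, pair q p ∊ prec → q ∊ pole → p ∊ pole

/-! ## Formulas -/

/-- Formulas of the language of non-extensional set theory, expanded by class symbols indexed by
`C`, in a context of `n` variables. The variables are numbered from the outside, so that the
variable bound by a quantifier in context `n` is number `n`. Parameters are the values of the
variables. -/
inductive Fml (C : Type) : ℕ → Type
  | top {n : ℕ} : Fml C n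
  | bot {n : ℕ} : Fml C n
  /-- `x` is not a strong element of `y` -/
  | notEps {n : ℕ} (x y : Fin n) : Fml C n
  /-- `x ≠ y` -/
  | ne {n : ℕ} (x y : Fin n) : Fml C n
  /-- `x ∉ y` -/
  | notMem {n : ℕ} (x y : Fin n) : Fml C n
  /-- `x ⊆ y` -/
  | sub {n : ℕ} (x y : Fin n) : Fml C n
  /-- `x` is not a strong element of the class `X` -/
  | notEpsC {n : ℕ} (x : Fin n) (X : C) : Fml C n
  /-- `x ∉ X` -/
  | notMemC {n : ℕ} (x : Fin n) (X : C) : Fml C n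
  /-- `x ⊆ X` -/
  | subC {n : ℕ} (x : Fin n) (X : C) : Fml C n
  | imp {n : ℕ} (φ ψ : Fml C n) : Fml C n
  | all {n : ℕ} (φ : Fml C (n + 1)) : Fml C n
  /-- the bounded quantifier `∀ x^X` -/
  | allC {n : ℕ} (X : C) (φ : Fml C (n + 1)) : Fml C n

namespace Fml

variable {C : Type} {n : ℕ}

def neg (φ : Fml C n) : Fml C n := imp φ bot
def and (φ ψ : Fml C n) : Fml C n := imp (imp φ (imp ψ bot)) bot
def ex (φ : Fml C (n + 1)) : Fml C n := imp (all (imp φ bot)) bot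
def eps (x y : Fin n) : Fml C n := neg (notEps x y)
def mem (x y : Fin n) : Fml C n := neg (notMem x y)
def epsC (x : Fin n) (X : C) : Fml C n := neg (notEpsC x X)
def memC (x : Fin n) (X : C) : Fml C n := neg (notMemC x X)

/-- `∀ y ε x, φ`, where `y` is the new variable -/
def allEps (x : Fin n) (φ : Fml C (n + 1)) : Fml C n := all (imp (eps (Fin.last n) x.castSucc) φ)

/-- `∀ y ∈ x, φ`, where `y` is the new variable -/
def allMem (x : Fin n) (φ : Fml C (n + 1)) : Fml C n := all (imp (mem (Fin.last n) x.castSucc) φ)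

/-- `x` is `ε`-transitive: `∀ y ε x, ∀ z ε y, z ε x` -/
def epsTrans (x : Fin n) : Fml C n :=
  allEps x (allEps (Fin.last n) (eps (Fin.last (n + 1)) x.castSucc.castSucc))

/-- `x` is an `ε`-ordinal: an `ε`-transitive set of `ε`-transitive sets. -/
def ordEps (x : Fin n) : Fml C n := and (epsTrans x) (allEps x (epsTrans (Fin.last n)))

/-- `x` is `∈`-transitive: `∀ y ∈ x, ∀ z ∈ y, z ∈ x` -/
def memTrans (x : Fin n) : Fml C n :=
  allMem x (allMem (Fin.last n) (mem (Fin.last (n + 1)) x.castSucc.castSucc))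

/-- `x` is an (extensional) ordinal: an `∈`-transitive set of `∈`-transitive sets. -/
def ordMem (x : Fin n) : Fml C n := and (memTrans x) (allMem x (memTrans (Fin.last n)))

end Fml

/-! ## Names and the realizability interpretation -/

namespace RealizabilityAlgebra

variable {V : Type*} [setLang.Structure V] [ModelZF V] (𝓐 : RealizabilityAlgebra V)

/-- `t ∈ Λ` -/
def IsClosedTerm (t : V) : Prop := Krivine.IsClosedTerm 𝓐.A 𝓐.B t

/-- `π ∈ Π` -/
def IsStack (π : V) : Prop := Krivine.IsStack 𝓐.A 𝓐.B π

/-- `t ∈ 𝓡` -/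
def IsRealizer (t : V) : Prop := Krivine.IsRealizer 𝓐.A t

/-- Every element of `T` is a subset of `T × Π`. -/
def IsNameSet (T : V) : Prop :=
  ∀ x, x ∊ T → ∀ p, p ∊ x → ∃ b π, b ∊ T ∧ 𝓐.IsStack π ∧ p = pair b π

/-- The class `N` of names. By foundation, the union of the hierarchy
`N_α = ⋃_{β < α} 𝓟 (N_β × Π)` consists of the sets that belong to a set `T` all of whose elements
are subsets of `T × Π`. -/
def IsName (a : V) : Prop := ∃ T, 𝓐.IsNameSet T ∧ a ∊ T

/-- `t ⋆ π` lies in the pole. -/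
def InPole (t π : V) : Prop := proc t π ∊ 𝓐.pole

/-- The sets `P`, `Q` of `V` satisfy, on the set `T` of names, the equations of the simultaneous
recursion for `‖a ⊆ b‖` and `‖a ∉ b‖`; here `((a, b), ρ)` in `P` stands for `ρ ∈ ‖a ⊆ b‖`, and
`((a, b), ρ)` in `Q` for `ρ ∈ ‖a ∉ b‖`. -/
structure IsRecursion (T P Q : V) : Prop where
  names : 𝓐.IsNameSet T
  sub : ∀ a b, a ∊ T → b ∊ T → ∀ ρ, pair (pair a b) ρ ∊ P ↔
    ∃ c t π, pair c π ∊ a ∧ 𝓐.IsClosedTerm t ∧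
      (∀ σ, pair (pair c b) σ ∊ Q → 𝓐.InPole t σ) ∧ ρ = push t π
  notMem : ∀ a b, a ∊ T → b ∊ T → ∀ ρ, pair (pair a b) ρ ∊ Q ↔
    ∃ c t t' π, pair c π ∊ b ∧ 𝓐.IsClosedTerm t ∧ 𝓐.IsClosedTerm t' ∧
      (∀ σ, pair (pair a c) σ ∊ P → 𝓐.InPole t σ) ∧
      (∀ σ, pair (pair c a) σ ∊ P → 𝓐.InPole t' σ) ∧ ρ = push t (push t' π)

/-- The falsity value `‖a ⊆ b‖`, by the simultaneous recursion inside `V`. -/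
def falsSub (a b : V) : Set V :=
  {ρ | ∃ T P Q, 𝓐.IsRecursion T P Q ∧ a ∊ T ∧ b ∊ T ∧ pair (pair a b) ρ ∊ P}

/-- The falsity value `‖a ∉ b‖`, by the simultaneous recursion inside `V`. -/
def falsNotMem (a b : V) : Set V :=
  {ρ | ∃ T P Q, 𝓐.IsRecursion T P Q ∧ a ∊ T ∧ b ∊ T ∧ pair (pair a b) ρ ∊ Q}

/-- The truth value that belongs to a falsity value. -/
def truth (F : Set V) : Set V := {t | 𝓐.IsClosedTerm t ∧ ∀ π ∈ F, 𝓐.InPole t π}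

/-- The falsity value `‖a ∉ X‖` for a class `X` of pairs `(c, π)`, with `I c π` for `(c, π) ∈ X`. -/
def falsNotMemC (I : V → V → Prop) (a : V) : Set V :=
  {ρ | ∃ c t t' π, I c π ∧ t ∈ 𝓐.truth (𝓐.falsSub a c) ∧ t' ∈ 𝓐.truth (𝓐.falsSub c a) ∧
    ρ = push t (push t' π)}

/-- The falsity value of a formula, where `I X c π` says that `(c, π)` belongs to the class (of
pairs of a name and a stack) that interprets the class symbol `X`, and `v` gives the values of the
free variables, the parameters. -/
def fals {C : Type} (I : C → V → V → Prop) : {n : ℕ} → Fml C n → (Fin n → V) → Set V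
  | _, .top, _ => ∅
  | _, .bot, _ => {π | 𝓐.IsStack π}
  | _, .notEps x y, v => {π | 𝓐.IsStack π ∧ pair (v x) π ∊ v y}
  | _, .ne x y, v => {π | 𝓐.IsStack π ∧ v x = v y}
  | _, .notMem x y, v => 𝓐.falsNotMem (v x) (v y)
  | _, .sub x y, v => 𝓐.falsSub (v x) (v y)
  | _, .notEpsC x X, v => {π | 𝓐.IsStack π ∧ I X (v x) π}
  | _, .notMemC x X, v => 𝓐.falsNotMemC (I X) (v x)
  | _, .subC x X, v =>
      {ρ | ∃ c t π, pair c π ∊ v x ∧ t ∈ 𝓐.truth (𝓐.falsNotMemC (I X) c) ∧ ρ = push t π}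
  | _, .imp φ ψ, v => {ρ | ∃ t π, t ∈ 𝓐.truth (fals I φ v) ∧ π ∈ fals I ψ v ∧ ρ = push t π}
  | _, .all φ, v => {π | ∃ a, 𝓐.IsName a ∧ π ∈ fals I φ (Fin.snoc v a)}
  | _, .allC X φ, v => {π | ∃ a, (∃ σ, I X a σ) ∧ π ∈ fals I φ (Fin.snoc v a)}

/-- `t ⊩ φ`, for a closed term `t` and a formula `φ` with the parameters `v`. -/
def Realizes {C : Type} (I : C → V → V → Prop) {n : ℕ} (t : V) (φ : Fml C n) (v : Fin n → V) :
    Prop := t ∈ 𝓐.truth (𝓐.fals I φ v)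

/-- `𝓝 ⊩ φ`: the closed formula `φ` belongs to the realizability theory, that is, some realizer
(closed term without continuation constants) realizes it. -/
def Forces {C : Type} (I : C → V → V → Prop) (φ : Fml C 0) : Prop :=
  ∃ t, 𝓐.IsRealizer t ∧ 𝓐.Realizes I t φ Fin.elim0

/-! ## Recursive names -/

/-- `f` is, on the transitive set `T` of `V`, the recursively defined operation
`reish u = {(reish w, π) | w ∈ u, π ∈ Π}`. -/
def IsReishRecursion (T f : V) : Prop :=
  IsTransitive T ∧ ∀ u, u ∊ T → ∀ v, pair u v ∊ f ↔
    ∀ p, p ∊ v ↔ ∃ w w' π, w ∊ u ∧ pair w w' ∊ f ∧ 𝓐.IsStack π ∧ p = pair w' π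

/-- `a` is the recursive name `reish x` of the set `x`. -/
def IsReish (x a : V) : Prop := ∃ T f, 𝓐.IsReishRecursion T f ∧ x ∊ T ∧ pair x a ∊ f

/-- The class `{(reish α, π) | α ∈ Ord, π ∈ Π}`, as the interpretation of a single class symbol. -/
def ReishOrd (_ : Unit) (a π : V) : Prop := 𝓐.IsStack π ∧ ∃ α, IsOrd α ∧ 𝓐.IsReish α a

end RealizabilityAlgebra

/-- The class symbol for the class of the recursive names of ordinals. -/
abbrev rOrd : Unit := ()

end Krivine

/-!
The proof translates ordinary reasoning about sets into typed `λ_c`-terms.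

*Typing.* The terms of the model may be nonstandard, but all realizers that are needed are values
`Tm.val` of terms of the metatheory, in environments of closed terms of the model. As
`Tm.isSubst_val` identifies substitution with the extension of the environment, realizability obeys
the rules of a type system with falsity values as types: `Types.lam`, `Types.app`, `Types.callcc`,
and `Types.fix` for Turing's fixed point combinator, which realizes statements by induction. These
inductions take place inside the model, so the predicates involved have to be first-order definable;
the classes `DefPred`, `DefFun` and `DefSet` reduce this to instance resolution. No grammar has to
be constructed inside the model: the closed terms and the stacks form sets because the preorder of
the algebra is a set and is reflexive on all processes (`exists_bound`).

*Inclusion and membership.* In the simultaneous recursion for `‖a ⊆ b‖` and `‖a ∉ b‖`, the first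
value depends on itself under two negations, so a solution exists as a least fixed point
(`exists_isRecursion`), and it is unique by induction (`IsRecursion.unique`). The resulting
equations `mem_falsSub` and `mem_falsNotMem` say that `a ∉ b` has the falsity value of
`∀ c, a ⊆ c → c ⊆ a → c notε b`, and likewise for `a ⊆ b`. Reflexivity and transitivity of `⊆`
follow by induction.

*Proper class.* Given a name `a`, consider `c` in its domain and closed terms `s`, `s'`. If `s`
realizes `reish β ⊆ c` and `s'` realizes `c ⊆ reish γ` for some `γ ∈ β`, then a fixed term applied
to `s`, `s'` realizes `⊥`, since `reish γ ∈ reish β` but `reish γ ∉ reish γ`. So it suffices to find an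
ordinal `β` that is not, for any such triple, the only ordinal with `s ⊩ reish β ⊆ c` and
`s' ⊩ c ⊆ reish β`. The ordinals to be avoided form a set by replacement
(`exists_types_separating`).

*Ordinals.* Any ordinal `x` of the realizability model is comparable with any `reish β`
(`Types.comparable`, a double induction). Choosing `β` with `reish β ∉ x` leaves only cases in which
`x ∈ R` (`Types.memR_of_ord`). Conversely, a set equal to some `reish β` is an ordinal, because
the elements of `reish β` are the `reish γ` with `γ ∈ β` (`Types.ord_of_memR`). The other claims
follow from the same description of the elements of `reish β`.
-/

namespace Krivine

/-! ### Definability with parameters -/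

section Definability

open FirstOrder FirstOrder.Language Set

variable {V : Type*} [setLang.Structure V]

/-- The predicate `P` on `n`-tuples is first-order definable with parameters. This is a class, so
that definability is established by instance resolution along the syntax of `P`. -/
class DefPred {n : ℕ} (P : (Fin n → V) → Prop) : Prop where
  out : (Set.univ : Set V).Definable setLang {v | P v}

/-- The operation `f` on `n`-tuples is first-order definable with parameters. -/
class DefFun {n : ℕ} (f : (Fin n → V) → V) : Prop where
  out : (Set.univ : Set V).DefinableFun setLang f

/-- The family `F` of classes, indexed by `n`-tuples, is uniformly first-order definable with
parameters. -/
class DefSet {n : ℕ} (F : (Fin n → V) → Set V) : Prop where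
  out : DefPred fun w : Fin (n + 1) → V => w (Fin.last n) ∈ F fun i => w i.castSucc

variable {n k : ℕ}

theorem DefPred.comp {P : (Fin k → V) → Prop} (hP : DefPred P) (F : Fin k → (Fin n → V) → V)
    (hF : ∀ i, DefFun (F i)) : DefPred fun v => P fun i => F i v :=
  ⟨hP.out.preimage_map (F := fun v i => F i v) fun i => (hF i).out⟩

theorem DefFun.comp {g : (Fin k → V) → V} (hg : DefFun g) (F : Fin k → (Fin n → V) → V)
    (hF : ∀ i, DefFun (F i)) : DefFun fun v => g fun i => F i v :=
  ⟨Set.DefinableFun.comp (g := fun v i => F i v) (fun i => (hF i).out) hg.out⟩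

instance defFun_proj (i : Fin n) : DefFun fun v : Fin n → V => v i :=
  ⟨Set.DefinableFun.proj _⟩

instance defFun_const (c : V) : DefFun fun _ : Fin n → V => c :=
  ⟨FirstOrder.Language.definableFun_const _ _ (Set.mem_univ c)⟩

theorem DefPred.congr {P Q : (Fin n → V) → Prop} (h : ∀ v, P v ↔ Q v) (hP : DefPred P) :
    DefPred Q := by
  have : P = Q := funext fun v => propext (h v)
  rwa [← this]

theorem DefPred.comp1 {P : V → Prop} (hP : DefPred fun v : Fin 1 → V => P (v 0))
    {f : (Fin n → V) → V} (hf : DefFun f) : DefPred fun v => P (f v) :=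
  hP.comp ![f] (by simpa using hf)

theorem DefPred.comp2 {P : V → V → Prop} (hP : DefPred fun v : Fin 2 → V => P (v 0) (v 1))
    {f g : (Fin n → V) → V} (hf : DefFun f) (hg : DefFun g) : DefPred fun v => P (f v) (g v) :=
  hP.comp ![f, g] (by simpa [Fin.forall_fin_succ] using ⟨hf, hg⟩)

theorem DefPred.comp3 {P : V → V → V → Prop}
    (hP : DefPred fun v : Fin 3 → V => P (v 0) (v 1) (v 2))
    {f g h : (Fin n → V) → V} (hf : DefFun f) (hg : DefFun g) (hh : DefFun h) :
    DefPred fun v => P (f v) (g v) (h v) :=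
  hP.comp ![f, g, h] (by simpa [Fin.forall_fin_succ] using ⟨hf, hg, hh⟩)

theorem DefFun.comp1 {F : V → V} (hF : DefFun fun v : Fin 1 → V => F (v 0))
    {f : (Fin n → V) → V} (hf : DefFun f) : DefFun fun v => F (f v) :=
  hF.comp ![f] (by simpa using hf)

theorem DefFun.comp2 {F : V → V → V} (hF : DefFun fun v : Fin 2 → V => F (v 0) (v 1))
    {f g : (Fin n → V) → V} (hf : DefFun f) (hg : DefFun g) : DefFun fun v => F (f v) (g v) :=
  hF.comp ![f, g] (by simpa [Fin.forall_fin_succ] using ⟨hf, hg⟩)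

instance defPred_mem (f g : (Fin n → V) → V) [hf : DefFun f] [hg : DefFun g] :
    DefPred fun v => f v ∊ g v :=
  DefPred.comp2 (P := Mem) ⟨Definable.mono (empty_definable_iff.2
    ⟨(Relations.formula₂ (L := setLang) (MemSymb.mem : setLang.Relations 2) (Term.var 0)
      (Term.var 1)), by
        ext v
        exact (Formula.realize_rel₂ (L := setLang) (M := V) (v := v) (R := MemSymb.mem)
          (t₁ := Term.var 0) (t₂ := Term.var 1)).symm⟩)
    (Set.empty_subset _)⟩ hf hg

instance defPred_eq (f g : (Fin n → V) → V) [hf : DefFun f] [hg : DefFun g] :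
    DefPred fun v => f v = g v :=
  ⟨hf.out.ofPred_eq hg.out⟩

instance defPred_const (p : Prop) : DefPred fun _ : Fin n → V => p := by
  by_cases hp : p
  · exact ⟨by simp [hp]⟩
  · exact ⟨by simp [hp]⟩

instance defPred_and (P Q : (Fin n → V) → Prop) [hP : DefPred P] [hQ : DefPred Q] :
    DefPred fun v => P v ∧ Q v := ⟨hP.out.inter hQ.out⟩

instance defPred_or (P Q : (Fin n → V) → Prop) [hP : DefPred P] [hQ : DefPred Q] :
    DefPred fun v => P v ∨ Q v := ⟨hP.out.union hQ.out⟩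

instance defPred_not (P : (Fin n → V) → Prop) [hP : DefPred P] :
    DefPred fun v => ¬ P v := ⟨hP.out.compl⟩

instance defPred_imp (P Q : (Fin n → V) → Prop) [hP : DefPred P] [hQ : DefPred Q] :
    DefPred fun v => P v → Q v :=
  DefPred.congr (fun _ => imp_iff_not_or.symm) (inferInstanceAs (DefPred fun v => ¬ P v ∨ Q v))

instance defPred_iff (P Q : (Fin n → V) → Prop) [hP : DefPred P] [hQ : DefPred Q] :
    DefPred fun v => P v ↔ Q v :=
  DefPred.congr (fun _ => iff_iff_implies_and_implies.symm)
    (inferInstanceAs (DefPred fun v => (P v → Q v) ∧ (Q v → P v)))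

instance defPred_exists (P : (Fin n → V) → V → Prop)
    [hP : DefPred fun w : Fin (n + 1) → V => P (fun i => w i.castSucc) (w (Fin.last n))] :
    DefPred fun v => ∃ x, P v x := by
  refine ⟨?_⟩
  convert! hP.out.image_comp (Fin.castSucc : Fin n → Fin (n + 1)) using 1
  ext v
  constructor
  · rintro ⟨x, hx⟩
    exact ⟨Fin.snoc v x, by simpa using hx, by ext i; simp⟩
  · rintro ⟨w, hw, rfl⟩
    exact ⟨w (Fin.last n), hw⟩

instance defPred_forall (P : (Fin n → V) → V → Prop)
    [hP : DefPred fun w : Fin (n + 1) → V => P (fun i => w i.castSucc) (w (Fin.last n))] :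
    DefPred fun v => ∀ x, P v x :=
  DefPred.congr (P := fun v => ¬ ∃ x, ¬ P v x) (fun _ => by simp) inferInstance

instance defPred_mem_set (f : (Fin n → V) → V) (F : (Fin n → V) → Set V) [hf : DefFun f]
    [hF : DefSet F] : DefPred fun v => f v ∈ F v := by
  have := hF.out.comp (Fin.snoc (α := fun _ => (Fin n → V) → V) (fun i v => v i) f)
    (fun i => by
      refine Fin.lastCases ?_ (fun j => ?_) i
      · simpa using hf
      · simpa using defFun_proj j)
  simpa using this

/-- An operation is definable as soon as its graph is. -/
theorem DefFun.of_graph {f : (Fin n → V) → V}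
    (h : DefPred fun w : Fin (n + 1) → V => w (Fin.last n) = f fun i => w i.castSucc) :
    DefFun f := by
  refine ⟨?_⟩
  have := h.out.preimage_comp (Fin.lastCases none some : Fin (n + 1) → Option (Fin n))
  unfold Set.DefinableFun
  convert! this using 1
  ext v
  simp [Function.tupleGraph, Function.comp_def, eq_comm]

theorem DefSet.reindex {F : (Fin n → V) → Set V} (hF : DefSet F) (σ : Fin n → Fin k) :
    DefSet fun w : Fin k → V => F fun i => w (σ i) :=
  ⟨hF.out.comp (fun i => Fin.lastCases (fun w => w (Fin.last _)) (fun j w => w (σ j).castSucc) i)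
    (fun i => by
      refine Fin.lastCases ?_ (fun j => ?_) i
      · simpa using defFun_proj _
      · simpa using defFun_proj _) |>.congr (fun w => by simp)⟩

end Definability

/-! ### Set theory in the model -/

section SetTheory

variable {V : Type*} [setLang.Structure V] [ModelZF V] {n : ℕ}

theorem sep (a : V) (P : V → Prop) [h : DefPred fun v : Fin 1 → V => P (v 0)] :
    ∃ c : V, ∀ x, x ∊ c ↔ x ∊ a ∧ P x :=
  ModelZF.separation {x | P x} h.out a

theorem repl (a : V) (F : V → V → Prop) [h : DefPred fun v : Fin 2 → V => F (v 0) (v 1)]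
    (hF : ∀ x, x ∊ a → ∀ y z, F x y → F x z → y = z) :
    ∃ c : V, ∀ y, y ∊ c ↔ ∃ x, x ∊ a ∧ F x y :=
  ModelZF.replacement F h.out a hF

theorem ext {a b : V} (h : ∀ x, x ∊ a ↔ x ∊ b) : a = b := ModelZF.extensionality a b h

instance defFun_upair (f g : (Fin n → V) → V) [hf : DefFun f] [hg : DefFun g] :
    DefFun fun v => upair (f v) (g v) :=
  DefFun.comp2 (.of_graph (.congr (P := fun w => ∀ x, x ∊ w 2 ↔ x = w 0 ∨ x = w 1)
    (fun _ => ⟨fun h => ext fun x => (h x).trans (mem_upair _ _ x).symm,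
      fun h x => (iff_of_eq (congrArg (x ∊ ·) h)).trans (mem_upair _ _ x)⟩) inferInstance)) hf hg

instance defFun_sUnion (f : (Fin n → V) → V) [hf : DefFun f] : DefFun fun v => sUnion (f v) :=
  DefFun.comp1 (.of_graph (.congr (P := fun w => ∀ x, x ∊ w 1 ↔ ∃ y, y ∊ w 0 ∧ x ∊ y)
    (fun _ => ⟨fun h => ext fun x => (h x).trans (mem_sUnion _ x).symm,
      fun h x => (iff_of_eq (congrArg (x ∊ ·) h)).trans (mem_sUnion _ x)⟩) inferInstance)) hf

section

variable (f g : (Fin n → V) → V) [hf : DefFun f] [hg : DefFun g]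

instance defFun_pair : DefFun fun v => pair (f v) (g v) := by unfold pair; infer_instance
instance defFun_succ : DefFun fun v => succ (f v) := by unfold succ; infer_instance
instance defFun_tVar : DefFun fun v => tVar (f v) := by unfold tVar; infer_instance
instance defFun_tApp : DefFun fun v => tApp (f v) (g v) := by unfold tApp; infer_instance
instance defFun_tLam : DefFun fun v => tLam (f v) := by unfold tLam; infer_instance
instance defFun_tCont : DefFun fun v => tCont (f v) := by unfold tCont; infer_instance
instance defFun_tInstr : DefFun fun v => tInstr (f v) := by unfold tInstr; infer_instance
instance defFun_sBot : DefFun fun v => sBot (f v) := by unfold sBot; infer_instance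
instance defFun_push : DefFun fun v => push (f v) (g v) := by unfold push; infer_instance
instance defFun_proc : DefFun fun v => proc (f v) (g v) := by unfold proc; infer_instance

instance defPred_isNat : DefPred fun v => IsNat (f v) :=
  DefPred.comp1 (by unfold IsNat; infer_instance) hf
instance defPred_isTransitive : DefPred fun v => IsTransitive (f v) :=
  DefPred.comp1 (by unfold IsTransitive; infer_instance) hf
instance defPred_isOrd : DefPred fun v => IsOrd (f v) :=
  DefPred.comp1 (by unfold IsOrd; infer_instance) hf

end

theorem exists_union (a b : V) : ∃ c : V, ∀ x, x ∊ c ↔ x ∊ a ∨ x ∊ b :=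
  ⟨sUnion (upair a b), fun x => by simp [mem_sUnion, mem_upair]⟩

theorem exists_prod (a b : V) :
    ∃ c : V, ∀ x, x ∊ c ↔ ∃ y z, y ∊ a ∧ z ∊ b ∧ x = pair y z := by
  obtain ⟨u, hu⟩ := exists_union a b
  obtain ⟨p, hp⟩ := ModelZF.powerset u
  obtain ⟨q, hq⟩ := ModelZF.powerset p
  obtain ⟨c, hc⟩ := sep q fun x => ∃ y z, y ∊ a ∧ z ∊ b ∧ x = pair y z
  refine ⟨c, fun x => (hc x).trans (and_iff_right_of_imp ?_)⟩
  rintro ⟨y, z, hy, hz, rfl⟩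
  rw [hq]
  intro w hw
  rw [hp]
  intro s hs
  rw [hu]
  rcases (mem_upair _ _ _).1 hw with rfl | rfl <;> rcases (mem_upair _ _ _).1 hs with rfl | rfl <;>
    simp [*]

/-- The Cartesian product. -/
noncomputable def prod (a b : V) : V := Classical.choose (exists_prod a b)

theorem mem_prod {a b x : V} : x ∊ prod a b ↔ ∃ y z, y ∊ a ∧ z ∊ b ∧ x = pair y z :=
  Classical.choose_spec (exists_prod a b) x

theorem pair_mem_prod {a b y z : V} : pair y z ∊ prod a b ↔ y ∊ a ∧ z ∊ b := by
  rw [mem_prod]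
  constructor
  · rintro ⟨y', z', hy, hz, h⟩
    obtain ⟨rfl, rfl⟩ := pair_inj h
    exact ⟨hy, hz⟩
  · rintro ⟨hy, hz⟩
    exact ⟨y, z, hy, hz, rfl⟩

/-- Both components of the pairs in `a` belong to `⋃ ⋃ a`. -/
theorem mem_sUnion_of_pair_mem {a x y : V} (h : pair x y ∊ a) :
    x ∊ sUnion (sUnion a) ∧ y ∊ sUnion (sUnion a) := by
  have h1 : upair x y ∊ sUnion a :=
    (mem_sUnion _ _).2 ⟨_, h, (mem_upair _ _ _).2 (Or.inr rfl)⟩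
  exact ⟨(mem_sUnion _ _).2 ⟨_, h1, (mem_upair _ _ _).2 (Or.inl rfl)⟩,
    (mem_sUnion _ _).2 ⟨_, h1, (mem_upair _ _ _).2 (Or.inr rfl)⟩⟩

theorem not_mem_self (a : V) : ¬ a ∊ a := by
  intro h
  obtain ⟨x, hx, hx'⟩ := ModelZF.foundation (upair a a) ⟨a, (mem_upair _ _ _).2 (Or.inl rfl)⟩
  obtain rfl : x = a := by simpa [mem_upair] using hx
  exact hx' x h hx

/-! ### Natural numbers and ordinals of the model -/

theorem isNat_empty : IsNat (empty : V) := fun _ h _ => h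

theorem IsNat.succ {m : V} (h : IsNat m) : IsNat (succ m) := fun S h0 hS => hS _ (h S h0 hS)

theorem isNat_num : ∀ i : ℕ, IsNat (num i : V)
  | 0 => isNat_empty
  | i + 1 => (isNat_num i).succ

theorem num_mem_num {i : ℕ} : ∀ {j : ℕ}, i < j → (num i : V) ∊ num j
  | j + 1, h => (mem_succ _ _).2 <| by
      rcases Nat.lt_succ_iff_lt_or_eq.1 h with h | rfl
      · exact Or.inl (num_mem_num h)
      · exact Or.inr rfl

theorem IsNat.induction (P : V → Prop) [DefPred fun v : Fin 1 → V => P (v 0)] (h0 : P empty)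
    (hs : ∀ x, IsNat x → P x → P (Krivine.succ x)) {m : V} (hm : IsNat m) : P m := by
  obtain ⟨w, ⟨e, he, he'⟩, hw⟩ := ModelZF.infinity (V := V)
  obtain rfl : e = empty := ext fun x => iff_of_false (he' x) (not_mem_empty x)
  obtain ⟨c, hc⟩ := sep w fun x => IsNat x ∧ P x
  refine ((hc m).1 (hm c ((hc _).2 ⟨he, isNat_empty, h0⟩) fun x hx => ?_)).2.2
  obtain ⟨hxw, hx, hPx⟩ := (hc x).1 hx
  obtain ⟨y, hy, hy'⟩ := hw x hxw
  obtain rfl : y = Krivine.succ x := ext fun z => (hy' z).trans (mem_succ x z).symm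
  exact (hc _).2 ⟨hy, hx.succ, hs x hx hPx⟩

theorem IsNat.isTransitive {m : V} (hm : IsNat m) : IsTransitive m := by
  refine IsNat.induction (fun m => IsTransitive m) (fun x hx => (not_mem_empty x hx).elim) ?_ hm
  intro m _ ih x hx y hy
  rcases (mem_succ _ _).1 hx with hx | rfl
  · exact (mem_succ _ _).2 (Or.inl (ih x hx y hy))
  · exact (mem_succ _ _).2 (Or.inl hy)

theorem IsNat.succ_mem_succ {m : V} (hm : IsNat m) :
    ∀ x, x ∊ m → Krivine.succ x ∊ Krivine.succ m := by
  refine IsNat.induction (fun m => ∀ x, x ∊ m → Krivine.succ x ∊ Krivine.succ m)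
    (fun x hx => (not_mem_empty x hx).elim) ?_ hm
  intro m _ ih x hx
  rcases (mem_succ _ _).1 hx with hx | rfl
  · exact (mem_succ _ _).2 (Or.inl (ih x hx))
  · exact (mem_succ _ _).2 (Or.inr rfl)

/-- `m ≤ k`, for natural numbers of the model. -/
def NatLE (m k : V) : Prop := IsNat k ∧ m ∊ succ k

instance defPred_natLE (f g : (Fin n → V) → V) [hf : DefFun f] [hg : DefFun g] :
    DefPred fun v => NatLE (f v) (g v) := by unfold NatLE; infer_instance

theorem NatLE.succ {m k : V} (h : NatLE m k) : NatLE (succ m) (succ k) :=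
  ⟨h.1.succ, h.1.succ.succ_mem_succ _ h.2⟩

theorem NatLE.mem {m k i : V} (h : NatLE m k) (hi : i ∊ m) : i ∊ k := by
  rcases (mem_succ _ _).1 h.2 with h' | rfl
  · exact h.1.isTransitive _ h' _ hi
  · exact hi

theorem NatLE.empty {k : V} (h : IsNat k) : NatLE empty k := by
  refine ⟨h, IsNat.induction (fun k => Krivine.empty ∊ Krivine.succ k) ?_ ?_ h⟩
  · exact (mem_succ _ _).2 (Or.inr rfl)
  · exact fun x _ hx => (mem_succ _ _).2 (Or.inl hx)

omit [ModelZF V] in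
theorem IsOrd.mem {a x : V} (h : IsOrd a) (hx : x ∊ a) : IsOrd x :=
  ⟨h.2 x hx, fun y hy => h.2 y (h.1 x hx y hy)⟩

theorem IsOrd.succ {a : V} (h : IsOrd a) : IsOrd (succ a) := by
  constructor
  · intro x hx y hy
    rcases (mem_succ _ _).1 hx with hx | rfl
    · exact (mem_succ _ _).2 (Or.inl (h.1 x hx y hy))
    · exact (mem_succ _ _).2 (Or.inl hy)
  · intro x hx
    rcases (mem_succ _ _).1 hx with hx | rfl
    · exact h.2 x hx
    · exact h.1

theorem IsOrd.induction (P : V → Prop) [DefPred fun v : Fin 1 → V => P (v 0)]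
    (h : ∀ a, IsOrd a → (∀ b, b ∊ a → P b) → P a) {a : V} (ha : IsOrd a) : P a := by
  by_contra hPa
  obtain ⟨c, hc⟩ := sep (Krivine.succ a) fun x => ¬ P x
  obtain ⟨b, hb, hb'⟩ := ModelZF.foundation c
    ⟨a, (hc a).2 ⟨(mem_succ _ _).2 (Or.inr rfl), hPa⟩⟩
  obtain ⟨hba, hPb⟩ := (hc b).1 hb
  refine hPb (h b (ha.succ.mem hba) fun x hx => ?_)
  by_contra hPx
  exact hb' x hx ((hc x).2 ⟨ha.succ.1 b hba x hx, hPx⟩)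

theorem IsOrd.trichotomy {a : V} (ha : IsOrd a) : ∀ b, IsOrd b → a ∊ b ∨ a = b ∨ b ∊ a := by
  refine IsOrd.induction (fun a => ∀ b, IsOrd b → a ∊ b ∨ a = b ∨ b ∊ a) ?_ ha
  intro a ha iha b hb
  refine IsOrd.induction (fun b => a ∊ b ∨ a = b ∨ b ∊ a) ?_ hb
  intro b hb ihb
  by_contra! hcon
  obtain ⟨h1, h2, h3⟩ := hcon
  refine h2 (ext fun x => ⟨fun hx => ?_, fun hx => ?_⟩)
  · rcases iha x hx b hb with h | rfl | h
    · exact h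
    · exact (h3 hx).elim
    · exact (h3 (ha.1 x hx b h)).elim
  · rcases ihb x hx with h | rfl | h
    · exact (h1 (hb.1 x hx a h)).elim
    · exact (h1 hx).elim
    · exact h

/-- No set contains all ordinals. -/
theorem exists_isOrd_not_mem (a : V) : ∃ b, IsOrd b ∧ ¬ b ∊ a := by
  by_contra! h
  obtain ⟨c, hc⟩ := sep a fun x => IsOrd x
  have hc' : ∀ x, x ∊ c ↔ IsOrd x := fun x => (hc x).trans (and_iff_right_of_imp (h x))
  have : IsOrd c := ⟨fun x hx y hy => (hc' y).2 (((hc' x).1 hx).mem hy),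
    fun x hx => ((hc' x).1 hx).1⟩
  exact not_mem_self c ((hc' c).2 this)

end SetTheory

/-! ### Closed terms and substitution -/

section Terms

variable {V : Type*} [setLang.Structure V] [ModelZF V] {n : ℕ} {A B : V}

theorem grammarClosed_iff (S P : V) : GrammarClosed A B S P ↔
    (∀ n i, IsNat n → i ∊ n → pair n (tVar i) ∊ S) ∧
    (∀ n t s, pair n t ∊ S → pair n s ∊ S → pair n (tApp t s) ∊ S) ∧
    (∀ n t, IsNat n → pair (succ n) t ∊ S → pair n (tLam t) ∊ S) ∧
    (∀ n, IsNat n → pair n tCC ∊ S) ∧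
    (∀ n π, IsNat n → π ∊ P → pair n (tCont π) ∊ S) ∧
    (∀ n α, IsNat n → α ∊ A → pair n (tInstr α) ∊ S) ∧
    (∀ β, β ∊ B → sBot β ∊ P) ∧
    (∀ t π, pair empty t ∊ S → π ∊ P → push t π ∊ P) :=
  ⟨fun ⟨h1, h2, h3, h4, h5, h6, h7, h8⟩ => ⟨h1, h2, h3, h4, h5, h6, h7, h8⟩,
    fun ⟨h1, h2, h3, h4, h5, h6, h7, h8⟩ => ⟨h1, h2, h3, h4, h5, h6, h7, h8⟩⟩

instance defPred_grammarClosed (f g : (Fin n → V) → V) [hf : DefFun f] [hg : DefFun g] :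
    DefPred fun v => GrammarClosed A B (f v) (g v) :=
  DefPred.comp2 (P := GrammarClosed A B) (DefPred.congr
    (fun _ => (grammarClosed_iff _ _).symm) inferInstance) hf hg

instance defPred_isTerm (f g : (Fin n → V) → V) [hf : DefFun f] [hg : DefFun g] :
    DefPred fun v => IsTerm A B (f v) (g v) :=
  DefPred.comp2 (by unfold IsTerm; infer_instance) hf hg

instance defPred_isClosedTerm (f : (Fin n → V) → V) [hf : DefFun f] :
    DefPred fun v => IsClosedTerm A B (f v) :=
  DefPred.comp1 (by unfold IsClosedTerm; infer_instance) hf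

instance defPred_isStack (f : (Fin n → V) → V) [hf : DefFun f] :
    DefPred fun v => IsStack A B (f v) :=
  DefPred.comp1 (by unfold IsStack; infer_instance) hf

theorem IsStack.push {t π : V} (ht : IsClosedTerm A B t) (hπ : IsStack A B π) :
    IsStack A B (push t π) := fun S P h => h.push _ _ (ht S P h) (hπ S P h)

theorem IsTerm.app {m t s : V} (ht : IsTerm A B m t) (hs : IsTerm A B m s) :
    IsTerm A B m (tApp t s) := fun S P h => h.app _ _ _ (ht S P h) (hs S P h)

theorem IsTerm.lam {m t : V} (hm : IsNat m) (ht : IsTerm A B (succ m) t) :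
    IsTerm A B m (tLam t) := fun S P h => h.lam _ _ hm (ht S P h)

theorem isTerm_cc {m : V} (hm : IsNat m) : IsTerm A B m tCC := fun _ _ h => h.cc _ hm

theorem isClosedTerm_cont {π : V} (h : IsStack A B π) : IsClosedTerm A B (tCont π) :=
  fun S P hS => hS.cont _ _ isNat_empty (h S P hS)

theorem IsRealizer.isClosedTerm {t : V} (h : IsRealizer A t) : IsClosedTerm A B t :=
  fun S _ hS => h S ⟨hS.var, hS.app, hS.lam, hS.cc, hS.instr⟩

/-- A set of pairs `(m, t)` can be restricted to those whose first component may be increased. -/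
theorem exists_upward (S : V) : ∃ S' : V, ∀ m t, pair m t ∊ S' ↔
    pair m t ∊ S ∧ ∀ k, NatLE m k → pair k t ∊ S := by
  obtain ⟨c, hc⟩ := sep S fun x => ∃ m t, x = pair m t ∧ ∀ k, NatLE m k → pair k t ∊ S
  refine ⟨c, fun m t => (hc _).trans (and_congr_right fun _ => ?_)⟩
  constructor
  · rintro ⟨m', t', h, hk⟩
    obtain ⟨rfl, rfl⟩ := pair_inj h
    exact hk
  · exact fun h => ⟨m, t, rfl, h⟩

/-- Weakening: a closed term is a term in any number of variables. -/
theorem IsClosedTerm.isTerm {t k : V} (ht : IsClosedTerm A B t) (hk : IsNat k) :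
    IsTerm A B k t := by
  intro S P h
  obtain ⟨S', hS'⟩ := exists_upward S
  refine ((hS' _ _).1 (ht S' P ?_)).2 k (NatLE.empty hk)
  constructor
  · exact fun m i hm hi => (hS' _ _).2
      ⟨h.var _ _ hm hi, fun k hk => h.var _ _ hk.1 (hk.mem hi)⟩
  · intro m t s ht hs
    rw [hS'] at *
    exact ⟨h.app _ _ _ ht.1 hs.1, fun k hk => h.app _ _ _ (ht.2 k hk) (hs.2 k hk)⟩
  · intro m t hm ht
    rw [hS'] at *
    exact ⟨h.lam _ _ hm ht.1, fun k hk => h.lam _ _ hk.1 (ht.2 _ hk.succ)⟩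
  · exact fun m hm => (hS' _ _).2 ⟨h.cc _ hm, fun k hk => h.cc _ hk.1⟩
  · exact fun m π hm hπ => (hS' _ _).2 ⟨h.cont _ _ hm hπ, fun k hk => h.cont _ _ hk.1 hπ⟩
  · exact fun m α hm hα => (hS' _ _).2 ⟨h.instr _ _ hm hα, fun k hk => h.instr _ _ hk.1 hα⟩
  · exact h.bot
  · exact fun t π ht hπ => h.push _ _ ((hS' _ _).1 ht).1 hπ

/-- Weakening for realizers. -/
theorem IsRealizer.weaken {t k : V} (ht : IsRealizer A t) (hk : IsNat k) {S : V}
    (h : ContFreeClosed A S) : pair k t ∊ S := by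
  obtain ⟨S', hS'⟩ := exists_upward S
  refine ((hS' _ _).1 (ht S' ?_)).2 k (NatLE.empty hk)
  constructor
  · exact fun m i hm hi => (hS' _ _).2
      ⟨h.var _ _ hm hi, fun k hk => h.var _ _ hk.1 (hk.mem hi)⟩
  · intro m t s ht hs
    rw [hS'] at *
    exact ⟨h.app _ _ _ ht.1 hs.1, fun k hk => h.app _ _ _ (ht.2 k hk) (hs.2 k hk)⟩
  · intro m t hm ht
    rw [hS'] at *
    exact ⟨h.lam _ _ hm ht.1, fun k hk => h.lam _ _ hk.1 (ht.2 _ hk.succ)⟩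
  · exact fun m hm => (hS' _ _).2 ⟨h.cc _ hm, fun k hk => h.cc _ hk.1⟩
  · exact fun m α hm hα => (hS' _ _).2 ⟨h.instr _ _ hm hα, fun k hk => h.instr _ _ hk.1 hα⟩

/-- Substitution does not change closed terms. The set `stk` of all stacks is needed because the
grammars of terms and stacks are mutually recursive. -/
theorem IsClosedTerm.subst_self {t s k S stk : V} (ht : IsClosedTerm A B t)
    (hstk : ∀ π, π ∊ stk ↔ IsStack A B π) (h : SubstClosed A B s S) (hk : IsNat k) :
    pair k (pair t t) ∊ S := by
  obtain ⟨D, hD⟩ : ∃ D : V, ∀ m t, pair m (pair t t) ∊ S → pair m t ∊ D := by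
    refine ⟨prod (sUnion (sUnion S)) (sUnion (sUnion (sUnion (sUnion S)))), fun m t hmt => ?_⟩
    have h1 := mem_sUnion_of_pair_mem hmt
    exact pair_mem_prod.2 ⟨h1.1, (mem_sUnion_of_pair_mem h1.2).1⟩
  obtain ⟨S', hS'⟩ : ∃ S' : V, ∀ m t, pair m t ∊ S' ↔ IsTerm A B m t ∧
      pair m (pair t t) ∊ S ∧ ∀ k, NatLE m k → pair k (pair t t) ∊ S := by
    obtain ⟨c, hc⟩ := sep D fun x => ∃ m t, x = pair m t ∧ IsTerm A B m t ∧
      pair m (pair t t) ∊ S ∧ ∀ k, NatLE m k → pair k (pair t t) ∊ S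
    refine ⟨c, fun m t => (hc _).trans ?_⟩
    constructor
    · rintro ⟨_, m', t', h, h'⟩
      obtain ⟨rfl, rfl⟩ := pair_inj h
      exact h'
    · exact fun h => ⟨hD _ _ h.2.1, m, t, rfl, h⟩
  refine ((hS' _ _).1 (ht S' stk ?_)).2.2 k (NatLE.empty hk)
  constructor
  · exact fun m i hm hi => (hS' _ _).2 ⟨fun _ _ hSP => hSP.var _ _ hm hi,
      h.var_lt _ _ hm hi, fun k hk => h.var_lt _ _ hk.1 (hk.mem hi)⟩
  · intro m t s ht hs
    rw [hS'] at *
    exact ⟨ht.1.app hs.1, h.app _ _ _ _ _ ht.2.1 hs.2.1,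
      fun k hk => h.app _ _ _ _ _ (ht.2.2 k hk) (hs.2.2 k hk)⟩
  · intro m t hm ht
    rw [hS'] at *
    exact ⟨ht.1.lam hm, h.lam _ _ _ hm ht.2.1, fun k hk => h.lam _ _ _ hk.1 (ht.2.2 _ hk.succ)⟩
  · exact fun m hm => (hS' _ _).2 ⟨isTerm_cc hm, h.cc _ hm, fun k hk => h.cc _ hk.1⟩
  · exact fun m π hm hπ => (hS' _ _).2 ⟨fun _ _ hSP => hSP.cont _ _ hm ((hstk _).1 hπ _ _ hSP),
      h.cont _ _ hm ((hstk _).1 hπ), fun k hk => h.cont _ _ hk.1 ((hstk _).1 hπ)⟩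
  · exact fun m α hm hα => (hS' _ _).2 ⟨fun _ _ hSP => hSP.instr _ _ hm hα,
      h.instr _ _ hm hα, fun k hk => h.instr _ _ hk.1 hα⟩
  · exact fun β hβ => (hstk _).2 fun _ _ hSP => hSP.bot β hβ
  · exact fun t π ht hπ => (hstk _).2 (IsStack.push ((hS' _ _).1 ht).1 ((hstk _).1 hπ))

/-! ### Meta-level λ-terms and their values -/

/-- `λ_c`-terms of the metatheory without continuation constants, with de Bruijn indices; their free
variables stand for closed terms of the model, given by an environment. -/
inductive Tm : Type
  | var (i : ℕ)
  | app (t s : Tm)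
  | lam (t : Tm)
  | cc

/-- The environment `e` extended by the value `s` of the variable `0`. -/
def cons (s : V) (e : ℕ → V) : ℕ → V
  | 0 => s
  | i + 1 => e i

/-- The environment whose entries are all `cc`. -/
noncomputable def nilEnv : ℕ → V := fun _ => tCC

/-- The term of the model denoted by `t` in the scope of `k` abstractions: the variables with
indices below `k` are kept, the others are replaced by the closed terms that `e` assigns. -/
noncomputable def Tm.val : ℕ → (ℕ → V) → Tm → V
  | k, e, .var i => if i < k then tVar (num i) else e (i - k)
  | k, e, .app t s => tApp (val k e t) (val k e s)
  | k, e, .lam t => tLam (val (k + 1) e t)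
  | _, _, .cc => tCC

theorem Tm.isTerm_val {e : ℕ → V} (he : ∀ i, IsClosedTerm A B (e i)) (t : Tm) :
    ∀ k, IsTerm A B (num k) (t.val k e) := by
  induction t with
  | var i =>
    intro k
    unfold val
    split_ifs with h
    · exact fun _ _ hSP => hSP.var _ _ (isNat_num k) (num_mem_num h)
    · exact (he _).isTerm (isNat_num k)
  | app t s iht ihs => exact fun k => (iht k).app (ihs k)
  | lam t ih => exact fun k => (ih (k + 1)).lam (isNat_num k)
  | cc => exact fun k => isTerm_cc (isNat_num k)

theorem Tm.isRealizer_val {e : ℕ → V} (he : ∀ i, IsRealizer A (e i)) (t : Tm) :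
    IsRealizer A (t.val 0 e) := by
  intro S hS
  suffices h : ∀ k, pair (num k) (t.val k e) ∊ S from h 0
  induction t with
  | var i =>
    intro k
    unfold val
    split_ifs with h
    · exact hS.var _ _ (isNat_num k) (num_mem_num h)
    · exact (he _).weaken (isNat_num k) hS
  | app t s iht ihs => exact fun k => hS.app _ _ _ (iht k) (ihs k)
  | lam t ih => exact fun k => hS.lam _ _ (isNat_num k) (ih (k + 1))
  | cc => exact fun k => hS.cc _ (isNat_num k)

/-- Extending the environment is substitution for the variable `0`. -/
theorem Tm.isSubst_val {e : ℕ → V} {s stk : V} (hstk : ∀ π, π ∊ stk ↔ IsStack A B π)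
    (he : ∀ i, IsClosedTerm A B (e i)) (t : Tm) :
    IsSubst A B (t.val 1 e) s (t.val 0 (cons s e)) := by
  intro S hS
  suffices h : ∀ k, pair (num k) (pair (t.val (k + 1) e) (t.val k (cons s e))) ∊ S from h 0
  induction t with
  | var i =>
    intro k
    unfold val
    rcases lt_trichotomy i k with h | rfl | h
    · rw [if_pos (by omega), if_pos h]
      exact hS.var_lt _ _ (isNat_num k) (num_mem_num h)
    · rw [if_pos (by omega), if_neg (by omega), Nat.sub_self]
      exact hS.var_eq _ (isNat_num i)
    · rw [if_neg (by omega), if_neg (by omega), show i - k = (i - (k + 1)) + 1 by omega]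
      exact (he _).subst_self hstk hS (isNat_num k)
  | app t s iht ihs => exact fun k => hS.app _ _ _ _ _ (iht k) (ihs k)
  | lam t ih => exact fun k => hS.lam _ _ _ (isNat_num k) (ih (k + 1))
  | cc => exact fun k => hS.cc _ (isNat_num k)

end Terms

namespace RealizabilityAlgebra

variable {V : Type*} [setLang.Structure V] [ModelZF V] (𝓐 : RealizabilityAlgebra V) {n : ℕ}

/-! ### Evaluation and the pole -/

theorem isClosedTerm_cc : 𝓐.IsClosedTerm tCC := isTerm_cc isNat_empty

theorem exists_isStack : ∃ π, 𝓐.IsStack π := by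
  obtain ⟨β, hβ⟩ := 𝓐.B_nonempty
  exact ⟨sBot β, fun _ _ h => h.bot β hβ⟩

/-- A set contains all closed terms and all stacks, since a reflexive relation on the processes is
a set. -/
theorem exists_bound : ∃ U : V, ∀ t π, 𝓐.IsClosedTerm t → 𝓐.IsStack π → t ∊ U ∧ π ∊ U :=
  ⟨_, fun t π ht hπ =>
    have h := (mem_sUnion_of_pair_mem (𝓐.prec_refl (proc t π) ⟨t, π, ht, hπ, rfl⟩)).1
    mem_sUnion_of_pair_mem h⟩

/-- The stacks form a set. -/
theorem exists_stackSet : ∃ s : V, ∀ π, π ∊ s ↔ 𝓐.IsStack π := by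
  obtain ⟨U, hU⟩ := 𝓐.exists_bound
  obtain ⟨c, hc⟩ := sep U fun π => Krivine.IsStack 𝓐.A 𝓐.B π
  exact ⟨c, fun π => (hc π).trans
    (and_iff_right_of_imp fun h => (hU tCC π 𝓐.isClosedTerm_cc h).2)⟩

/-- The closed terms form a set. -/
theorem exists_termSet : ∃ s : V, ∀ t, t ∊ s ↔ 𝓐.IsClosedTerm t := by
  obtain ⟨U, hU⟩ := 𝓐.exists_bound
  obtain ⟨π, hπ⟩ := 𝓐.exists_isStack
  obtain ⟨c, hc⟩ := sep U fun t => Krivine.IsClosedTerm 𝓐.A 𝓐.B t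
  exact ⟨c, fun t => (hc t).trans (and_iff_right_of_imp fun h => (hU t π h hπ).1)⟩

variable {𝓐}

/-- The entries of the environment are closed terms. -/
class ClosedEnv (𝓐 : RealizabilityAlgebra V) (e : ℕ → V) : Prop where
  out : ∀ i, 𝓐.IsClosedTerm (e i)

theorem ClosedEnv.cons {e : ℕ → V} [he : 𝓐.ClosedEnv e] {s : V} (hs : 𝓐.IsClosedTerm s) :
    𝓐.ClosedEnv (cons s e) := ⟨fun i => by cases i; exacts [hs, he.out _]⟩

theorem isClosedTerm_val (e : ℕ → V) [he : 𝓐.ClosedEnv e] (t : Tm) :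
    𝓐.IsClosedTerm (t.val 0 e) := t.isTerm_val he.out 0

theorem InPole.app {t s π : V} (ht : 𝓐.IsClosedTerm t) (hs : 𝓐.IsClosedTerm s)
    (hπ : 𝓐.IsStack π) (h : 𝓐.InPole t (push s π)) : 𝓐.InPole (tApp t s) π :=
  𝓐.pole_closed _ _ (𝓐.prec_eval _ _ (.push t s π ht hs hπ)) h

theorem InPole.lam {e : ℕ → V} [he : 𝓐.ClosedEnv e] {t : Tm} {s π : V} (hs : 𝓐.IsClosedTerm s)
    (hπ : 𝓐.IsStack π) (h : 𝓐.InPole (t.val 0 (Krivine.cons s e)) π) :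
    𝓐.InPole (t.lam.val 0 e) (push s π) := by
  obtain ⟨stk, hstk⟩ := 𝓐.exists_stackSet
  exact 𝓐.pole_closed _ _ (𝓐.prec_eval _ _
    (.grab _ s _ π (t.isTerm_val he.out 1) hs hπ (t.isSubst_val hstk he.out))) h

theorem InPole.callcc {t π : V} (ht : 𝓐.IsClosedTerm t) (hπ : 𝓐.IsStack π)
    (h : 𝓐.InPole t (push (tCont π) π)) : 𝓐.InPole tCC (push t π) :=
  𝓐.pole_closed _ _ (𝓐.prec_eval _ _ (.save t π ht hπ)) h

theorem InPole.cont {t σ π : V} (ht : 𝓐.IsClosedTerm t) (hσ : 𝓐.IsStack σ) (hπ : 𝓐.IsStack π)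
    (h : 𝓐.InPole t σ) : 𝓐.InPole (tCont σ) (push t π) :=
  𝓐.pole_closed _ _ (𝓐.prec_eval _ _ (.restore t σ π ht hσ hπ)) h

/-! ### Falsity values, and realizability as a type system -/

/-- `F` is a falsity value: a class of stacks. -/
class IsFalsity (𝓐 : RealizabilityAlgebra V) (F : Set V) : Prop where
  out : ∀ π ∈ F, 𝓐.IsStack π

/-- The falsity value of an implication. -/
def arrow (𝓐 : RealizabilityAlgebra V) (F G : Set V) : Set V :=
  {ρ | ∃ t π, t ∈ 𝓐.truth F ∧ π ∈ G ∧ ρ = push t π}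

/-- The falsity value of `⊥`. -/
def falsBot (𝓐 : RealizabilityAlgebra V) : Set V := {π | 𝓐.IsStack π}

instance (F G : Set V) [hG : 𝓐.IsFalsity G] : 𝓐.IsFalsity (𝓐.arrow F G) :=
  ⟨by rintro _ ⟨t, π, ht, hπ, rfl⟩; exact IsStack.push ht.1 (hG.out π hπ)⟩

instance : 𝓐.IsFalsity 𝓐.falsBot := ⟨fun _ h => h⟩

theorem isFalsity_singleton {π : V} (h : 𝓐.IsStack π) : 𝓐.IsFalsity {π} :=
  ⟨by rintro _ rfl; exact h⟩

theorem truth_mono {F G : Set V} (h : F ⊆ G) : 𝓐.truth G ⊆ 𝓐.truth F :=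
  fun _ ht => ⟨ht.1, fun π hπ => ht.2 π (h hπ)⟩

/-- In the environment `e`, the term `t` realizes the falsity value `F`. -/
def Types (𝓐 : RealizabilityAlgebra V) (e : ℕ → V) (t : Tm) (F : Set V) : Prop :=
  t.val 0 e ∈ 𝓐.truth F

namespace Types

variable {e : ℕ → V} {t s : Tm} {F G : Set V}

theorem var (i : ℕ) (h : e i ∈ 𝓐.truth F) : 𝓐.Types e (.var i) F := by
  simpa [Types, Tm.val] using h

theorem mono (h : F ⊆ G) (ht : 𝓐.Types e t G) : 𝓐.Types e t F := truth_mono h ht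

/-- Ex falso. -/
theorem exfalso [hF : 𝓐.IsFalsity F] (ht : 𝓐.Types e t 𝓐.falsBot) : 𝓐.Types e t F :=
  ht.mono hF.out

theorem app [hG : 𝓐.IsFalsity G] (ht : 𝓐.Types e t (𝓐.arrow F G)) (hs : 𝓐.Types e s F) :
    𝓐.Types e (t.app s) G :=
  ⟨IsTerm.app ht.1 hs.1, fun π hπ => InPole.app ht.1 hs.1 (hG.out π hπ)
    (ht.2 _ ⟨_, π, hs, hπ, rfl⟩)⟩

theorem lam [he : 𝓐.ClosedEnv e] [hG : 𝓐.IsFalsity G]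
    (h : ∀ s ∈ 𝓐.truth F, 𝓐.ClosedEnv (cons s e) → 𝓐.Types (cons s e) t G) :
    𝓐.Types e t.lam (𝓐.arrow F G) := by
  refine ⟨isClosedTerm_val e _, ?_⟩
  rintro _ ⟨s, π, hs, hπ, rfl⟩
  exact InPole.lam hs.1 (hG.out π hπ) ((h s hs (.cons hs.1)).2 π hπ)

/-- Peirce's law. -/
theorem callcc [hF : 𝓐.IsFalsity F] [hG : 𝓐.IsFalsity G]
    (ht : 𝓐.Types e t (𝓐.arrow (𝓐.arrow F G) F)) : 𝓐.Types e (.app .cc t) F := by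
  refine ⟨IsTerm.app 𝓐.isClosedTerm_cc ht.1, fun π hπ => ?_⟩
  have hπ' := hF.out π hπ
  refine InPole.app 𝓐.isClosedTerm_cc ht.1 hπ' (InPole.callcc ht.1 hπ' (ht.2 _ ?_))
  refine ⟨_, π, ⟨isClosedTerm_cont hπ', ?_⟩, hπ, rfl⟩
  rintro _ ⟨s, ρ, hs, hρ, rfl⟩
  exact InPole.cont hs.1 hπ' (hG.out ρ hρ) (hs.2 π hπ)

end Types

end RealizabilityAlgebra

/-! ### Fixed points -/

/-- The half `λ a f, f (a a f)` of Turing's fixed point combinator. -/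
def Tm.turing : Tm := .lam (.lam (.app (.var 0) (.app (.app (.var 1) (.var 1)) (.var 0))))

/-- The fixed point of `t` with respect to the variable `0`. -/
def Tm.fix (t : Tm) : Tm := .app (.app .turing .turing) (.lam t)

namespace RealizabilityAlgebra

variable {V : Type*} [setLang.Structure V] [ModelZF V] {𝓐 : RealizabilityAlgebra V} {n : ℕ}

/-- A fixed point realizes what its body realizes in the environment that assigns the fixed point
itself to the variable `0`. -/
theorem Types.fix {e : ℕ → V} [he : 𝓐.ClosedEnv e] {t : Tm} {G : Set V} [hG : 𝓐.IsFalsity G]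
    (h : 𝓐.ClosedEnv (cons (t.fix.val 0 e) e) → 𝓐.Types (cons (t.fix.val 0 e) e) t G) :
    𝓐.Types e t.fix G := by
  refine ⟨isClosedTerm_val e _, fun π hπ => ?_⟩
  have hπ := hG.out π ‹_›
  have hA := isClosedTerm_val (𝓐 := 𝓐) e .turing
  have hL := isClosedTerm_val (𝓐 := 𝓐) e t.lam
  have hY := isClosedTerm_val (𝓐 := 𝓐) e t.fix
  have : 𝓐.ClosedEnv (cons (Tm.turing.val 0 e) e) := .cons hA
  refine InPole.app (IsTerm.app hA hA) hL hπ (InPole.app hA hA (IsStack.push hL hπ) ?_)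
  refine InPole.lam hA (IsStack.push hL hπ) (InPole.lam hL hπ ?_)
  refine InPole.app hL hY hπ (InPole.lam hY hπ ((h (.cons hY)).2 π ‹_›))

/-! ### Definability of realizability -/

instance defPred_isClosedTerm (f : (Fin n → V) → V) [hf : DefFun f] :
    DefPred fun v => 𝓐.IsClosedTerm (f v) :=
  Krivine.defPred_isClosedTerm f

instance defPred_isStack (f : (Fin n → V) → V) [hf : DefFun f] :
    DefPred fun v => 𝓐.IsStack (f v) :=
  Krivine.defPred_isStack f

instance defPred_inPole (f g : (Fin n → V) → V) [hf : DefFun f] [hg : DefFun g] :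
    DefPred fun v => 𝓐.InPole (f v) (g v) := by
  unfold InPole; infer_instance

instance defPred_isNameSet (f : (Fin n → V) → V) [hf : DefFun f] :
    DefPred fun v => 𝓐.IsNameSet (f v) :=
  DefPred.comp1 (by unfold IsNameSet; infer_instance) hf

instance defPred_isName (f : (Fin n → V) → V) [hf : DefFun f] :
    DefPred fun v => 𝓐.IsName (f v) :=
  DefPred.comp1 (by unfold IsName; infer_instance) hf

theorem isRecursion_iff (T P Q : V) : 𝓐.IsRecursion T P Q ↔ 𝓐.IsNameSet T ∧
    (∀ a b, a ∊ T → b ∊ T → ∀ ρ, pair (pair a b) ρ ∊ P ↔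
      ∃ c t π, pair c π ∊ a ∧ 𝓐.IsClosedTerm t ∧
        (∀ σ, pair (pair c b) σ ∊ Q → 𝓐.InPole t σ) ∧ ρ = push t π) ∧
    (∀ a b, a ∊ T → b ∊ T → ∀ ρ, pair (pair a b) ρ ∊ Q ↔
      ∃ c t t' π, pair c π ∊ b ∧ 𝓐.IsClosedTerm t ∧ 𝓐.IsClosedTerm t' ∧
        (∀ σ, pair (pair a c) σ ∊ P → 𝓐.InPole t σ) ∧
        (∀ σ, pair (pair c a) σ ∊ P → 𝓐.InPole t' σ) ∧ ρ = push t (push t' π)) :=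
  ⟨fun ⟨h1, h2, h3⟩ => ⟨h1, h2, h3⟩, fun ⟨h1, h2, h3⟩ => ⟨h1, h2, h3⟩⟩

instance defPred_isRecursion (f g h : (Fin n → V) → V) [hf : DefFun f] [hg : DefFun g]
    [hh : DefFun h] : DefPred fun v => 𝓐.IsRecursion (f v) (g v) (h v) :=
  DefPred.comp3 (P := 𝓐.IsRecursion)
    (.congr (fun _ => (isRecursion_iff _ _ _).symm) inferInstance) hf hg hh

instance defSet_falsSub (f g : (Fin n → V) → V) [hf : DefFun f] [hg : DefFun g] :
    DefSet fun v => 𝓐.falsSub (f v) (g v) :=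
  ⟨DefPred.comp3 (P := fun a b ρ => ρ ∈ 𝓐.falsSub a b) (by
    simp only [falsSub, Set.mem_ofPred_eq]; infer_instance)
    (hf.comp _ fun i => defFun_proj i.castSucc) (hg.comp _ fun i => defFun_proj i.castSucc)
    (defFun_proj _)⟩

instance defSet_falsNotMem (f g : (Fin n → V) → V) [hf : DefFun f] [hg : DefFun g] :
    DefSet fun v => 𝓐.falsNotMem (f v) (g v) :=
  ⟨DefPred.comp3 (P := fun a b ρ => ρ ∈ 𝓐.falsNotMem a b) (by
    simp only [falsNotMem, Set.mem_ofPred_eq]; infer_instance)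
    (hf.comp _ fun i => defFun_proj i.castSucc) (hg.comp _ fun i => defFun_proj i.castSucc)
    (defFun_proj _)⟩

instance defSet_truth (F : (Fin n → V) → Set V) [hF : DefSet F] :
    DefSet fun v => 𝓐.truth (F v) := by
  refine ⟨?_⟩
  simp only [truth, Set.mem_ofPred_eq]
  have := hF.reindex fun i => i.castSucc.castSucc
  infer_instance

instance defSet_arrow (F G : (Fin n → V) → Set V) [hF : DefSet F] [hG : DefSet G] :
    DefSet fun v => 𝓐.arrow (F v) (G v) := by
  refine ⟨?_⟩
  simp only [arrow, Set.mem_ofPred_eq]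
  have := hF.reindex fun i => i.castSucc.castSucc.castSucc
  have := hG.reindex fun i => i.castSucc.castSucc.castSucc
  infer_instance

instance defSet_falsBot : DefSet fun _ : Fin n → V => 𝓐.falsBot := by
  refine ⟨?_⟩
  simp only [falsBot, Set.mem_ofPred_eq]
  infer_instance

/-! ### Names -/

theorem IsNameSet.mem {T a c π : V} (hT : 𝓐.IsNameSet T) (ha : a ∊ T) (h : pair c π ∊ a) :
    c ∊ T ∧ 𝓐.IsStack π := by
  obtain ⟨b, ρ, hb, hρ, hp⟩ := hT a ha _ h
  obtain ⟨rfl, rfl⟩ := pair_inj hp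
  exact ⟨hb, hρ⟩

theorem IsName.mem {a c π : V} (ha : 𝓐.IsName a) (h : pair c π ∊ a) :
    𝓐.IsName c ∧ 𝓐.IsStack π := by
  obtain ⟨T, hT, haT⟩ := ha
  exact ⟨⟨T, hT, (hT.mem haT h).1⟩, (hT.mem haT h).2⟩

theorem IsNameSet.union {S T U : V} (hS : 𝓐.IsNameSet S) (hT : 𝓐.IsNameSet T)
    (hU : ∀ x, x ∊ U ↔ x ∊ S ∨ x ∊ T) : 𝓐.IsNameSet U := by
  intro x hx p hp
  rcases (hU x).1 hx with h | h
  · obtain ⟨b, π, hb, h'⟩ := hS x h p hp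
    exact ⟨b, π, (hU b).2 (Or.inl hb), h'⟩
  · obtain ⟨b, π, hb, h'⟩ := hT x h p hp
    exact ⟨b, π, (hU b).2 (Or.inr hb), h'⟩

/-- Induction on names along `{(b, a) | ∃ π, (b, π) ∈ a}`. Foundation is applied to a set that
contains, besides the counterexamples `b`, the sets `{b}` and `(b, π)` that lie between `b` and
`a`. -/
theorem IsName.induction (P : V → Prop) [DefPred fun v : Fin 1 → V => P (v 0)]
    (h : ∀ a, 𝓐.IsName a → (∀ b π, pair b π ∊ a → P b) → P a) {a : V} (ha : 𝓐.IsName a) :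
    P a := by
  by_contra hPa
  obtain ⟨T, hT, haT⟩ := ha
  obtain ⟨E, hE⟩ := sep T fun z => ¬ P z
  obtain ⟨D, hD⟩ : ∃ D : V, ∀ z, z ∊ D ↔ z ∊ E ∨
      (z ∊ sUnion (sUnion T) ∧ ∃ y, z = upair y y ∧ y ∊ E) ∨
      (z ∊ sUnion T ∧ ∃ y π, z = pair y π ∧ y ∊ E) := by
    obtain ⟨F, hF⟩ := sep (sUnion (sUnion T)) fun z => ∃ y, z = upair y y ∧ y ∊ E
    obtain ⟨G, hG⟩ := sep (sUnion T) fun z => ∃ y π, z = pair y π ∧ y ∊ E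
    obtain ⟨U, hU⟩ := exists_union F G
    obtain ⟨D, hD⟩ := exists_union E U
    exact ⟨D, fun z => by rw [hD, hU, hF, hG]⟩
  obtain ⟨m, hm, hmin⟩ := ModelZF.foundation D ⟨a, (hD a).2 (Or.inl ((hE a).2 ⟨haT, hPa⟩))⟩
  obtain hm | ⟨-, y, rfl, hy⟩ | ⟨hT', y, π, rfl, hy⟩ := (hD m).1 hm
  · obtain ⟨hmT, hPm⟩ := (hE m).1 hm
    refine hPm (h m ⟨T, hT, hmT⟩ fun b π hb => ?_)
    by_contra hPb
    exact hmin _ hb ((hD _).2 (Or.inr (Or.inr ⟨(mem_sUnion _ _).2 ⟨m, hmT, hb⟩,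
      b, π, rfl, (hE b).2 ⟨(hT.mem hmT hb).1, hPb⟩⟩)))
  · exact hmin y ((mem_upair _ _ _).2 (Or.inl rfl)) ((hD y).2 (Or.inl hy))
  · have hmem : upair y y ∊ pair y π := (mem_upair _ _ _).2 (Or.inl rfl)
    exact hmin _ hmem ((hD _).2 (Or.inr (Or.inl
      ⟨(mem_sUnion _ _).2 ⟨_, hT', hmem⟩, y, rfl, hy⟩)))

/-! ### The recursion for `‖a ⊆ b‖` and `‖a ∉ b‖` -/

/-- `ρ ∈ ‖a ∉ b‖`, when `P` gives the values `‖c ⊆ d‖`. -/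
def InNotMem (𝓐 : RealizabilityAlgebra V) (P a b ρ : V) : Prop :=
  ∃ c t t' π, pair c π ∊ b ∧ 𝓐.IsClosedTerm t ∧ 𝓐.IsClosedTerm t' ∧
    (∀ σ, pair (pair a c) σ ∊ P → 𝓐.InPole t σ) ∧
    (∀ σ, pair (pair c a) σ ∊ P → 𝓐.InPole t' σ) ∧ ρ = push t (push t' π)

/-- `ρ ∈ ‖a ⊆ b‖`, when `P` gives the values `‖c ⊆ d‖` that this depends on. The set `P` occurs
under two negations, so this operator is monotone in `P`. -/
def InSub (𝓐 : RealizabilityAlgebra V) (P a b ρ : V) : Prop :=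
  ∃ c t π, pair c π ∊ a ∧ 𝓐.IsClosedTerm t ∧
    (∀ σ, 𝓐.InNotMem P c b σ → 𝓐.InPole t σ) ∧ ρ = push t π

theorem InNotMem.mono {P P' T a b ρ : V} (hT : 𝓐.IsNameSet T) (ha : a ∊ T) (hb : b ∊ T)
    (h : ∀ c d σ, c ∊ T → d ∊ T → pair (pair c d) σ ∊ P' → pair (pair c d) σ ∊ P) :
    𝓐.InNotMem P a b ρ → 𝓐.InNotMem P' a b ρ := by
  rintro ⟨c, t, t', π, hc, ht, ht', h1, h2, rfl⟩
  have hcT := (hT.mem hb hc).1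
  exact ⟨c, t, t', π, hc, ht, ht', fun σ hσ => h1 σ (h _ _ _ ha hcT hσ),
    fun σ hσ => h2 σ (h _ _ _ hcT ha hσ), rfl⟩

theorem InSub.mono {P P' T a b ρ : V} (hT : 𝓐.IsNameSet T) (ha : a ∊ T) (hb : b ∊ T)
    (h : ∀ c d σ, c ∊ T → d ∊ T → pair (pair c d) σ ∊ P → pair (pair c d) σ ∊ P') :
    𝓐.InSub P a b ρ → 𝓐.InSub P' a b ρ := by
  rintro ⟨c, t, π, hc, ht, h1, rfl⟩
  exact ⟨c, t, π, hc, ht, fun σ hσ => h1 σ (hσ.mono hT (hT.mem ha hc).1 hb h), rfl⟩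

theorem InSub.isStack {P T a b ρ : V} (hT : 𝓐.IsNameSet T) (ha : a ∊ T) :
    𝓐.InSub P a b ρ → 𝓐.IsStack ρ := by
  rintro ⟨c, t, π, hc, ht, -, rfl⟩
  exact IsStack.push ht (hT.mem ha hc).2

theorem InNotMem.isStack {P T a b ρ : V} (hT : 𝓐.IsNameSet T) (hb : b ∊ T) :
    𝓐.InNotMem P a b ρ → 𝓐.IsStack ρ := by
  rintro ⟨c, t, t', π, hc, ht, ht', -, -, rfl⟩
  exact IsStack.push ht (IsStack.push ht' (hT.mem hb hc).2)

/-- The recursion has a solution on every set of names: `‖a ⊆ b‖` is given by the least fixed point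
of a monotone operator. -/
theorem exists_isRecursion {T : V} (hT : 𝓐.IsNameSet T) : ∃ P Q, 𝓐.IsRecursion T P Q := by
  obtain ⟨stk, hstk⟩ := 𝓐.exists_stackSet
  have hU : ∀ a b ρ, pair (pair a b) ρ ∊ prod (prod T T) stk ↔ (a ∊ T ∧ b ∊ T) ∧ 𝓐.IsStack ρ :=
    fun a b ρ => by rw [pair_mem_prod, pair_mem_prod, hstk]
  have hsep : ∀ R : V → V → V → Prop,
      (DefPred fun v : Fin 1 → V => ∃ a b ρ, v 0 = pair (pair a b) ρ ∧ R a b ρ) →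
      ∃ c : V, ∀ a b ρ, pair (pair a b) ρ ∊ c ↔ ((a ∊ T ∧ b ∊ T) ∧ 𝓐.IsStack ρ) ∧ R a b ρ := by
    intro R hR
    obtain ⟨c, hc⟩ := sep (prod (prod T T) stk)
      fun x => ∃ a b ρ, x = pair (pair a b) ρ ∧ R a b ρ
    refine ⟨c, fun a b ρ => ?_⟩
    rw [hc, hU]
    refine and_congr_right fun _ => ⟨?_, fun h => ⟨a, b, ρ, rfl, h⟩⟩
    rintro ⟨a', b', ρ', h, h'⟩
    obtain ⟨h, rfl⟩ := pair_inj h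
    obtain ⟨rfl, rfl⟩ := pair_inj ‹pair a b = pair a' b'›
    exact h'
  obtain ⟨P, hP⟩ := hsep (fun a b ρ => ∀ P', (∀ a b, a ∊ T → b ∊ T → ∀ ρ, 𝓐.InSub P' a b ρ →
    pair (pair a b) ρ ∊ P') → pair (pair a b) ρ ∊ P') (by
      unfold InSub InNotMem; infer_instance)
  -- `P` is the intersection of all sets closed under the operator, hence its least fixed point.
  have hP1 : ∀ a b ρ, a ∊ T → b ∊ T → 𝓐.InSub P a b ρ → pair (pair a b) ρ ∊ P := by
    intro a b ρ ha hb h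
    refine (hP _ _ _).2 ⟨⟨⟨ha, hb⟩, h.isStack hT ha⟩, fun P' hP' => hP' a b ha hb ρ ?_⟩
    exact h.mono hT ha hb fun c d σ _ _ hσ => ((hP _ _ _).1 hσ).2 P' hP'
  have hP2 : ∀ a b ρ, a ∊ T → b ∊ T → pair (pair a b) ρ ∊ P → 𝓐.InSub P a b ρ := by
    intro a b ρ ha hb h
    obtain ⟨P', hP'⟩ := hsep (fun a b ρ => 𝓐.InSub P a b ρ) (by
      unfold InSub InNotMem; infer_instance)
    refine ((hP' _ _ _).1 (((hP _ _ _).1 h).2 P' ?_)).2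
    intro a b ha hb ρ h
    refine (hP' _ _ _).2 ⟨⟨⟨ha, hb⟩, h.isStack hT ha⟩, h.mono hT ha hb ?_⟩
    exact fun c d σ hc hd hσ => hP1 c d σ hc hd ((hP' _ _ _).1 hσ).2
  obtain ⟨Q, hQ⟩ := hsep (fun a b ρ => 𝓐.InNotMem P a b ρ) (by
      unfold InNotMem; infer_instance)
  have hQ' : ∀ a b ρ, a ∊ T → b ∊ T → (pair (pair a b) ρ ∊ Q ↔ 𝓐.InNotMem P a b ρ) :=
    fun a b ρ ha hb => (hQ a b ρ).trans
      (and_iff_right_of_imp fun h => ⟨⟨ha, hb⟩, h.isStack hT hb⟩)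
  refine ⟨P, Q, hT, fun a b ha hb ρ => ?_, fun a b ha hb ρ => hQ' a b ρ ha hb⟩
  refine Iff.trans ⟨hP2 a b ρ ha hb, hP1 a b ρ ha hb⟩ (exists_congr fun c => exists_congr fun t =>
    exists_congr fun π => and_congr_right fun hc => and_congr_right fun _ =>
    and_congr_left fun _ => forall_congr' fun σ => ?_)
  rw [hQ' c b σ (hT.mem ha hc).1 hb]

theorem IsRecursion.notMem_iff {T P Q a b ρ : V} (h : 𝓐.IsRecursion T P Q) (ha : a ∊ T)
    (hb : b ∊ T) : pair (pair a b) ρ ∊ Q ↔ 𝓐.InNotMem P a b ρ := h.notMem a b ha hb ρ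

theorem IsRecursion.sub_iff {T P Q a b ρ : V} (h : 𝓐.IsRecursion T P Q) (ha : a ∊ T)
    (hb : b ∊ T) : pair (pair a b) ρ ∊ P ↔ 𝓐.InSub P a b ρ := by
  refine (h.sub a b ha hb ρ).trans (exists_congr fun c => exists_congr fun t =>
    exists_congr fun π => and_congr_right fun hc => and_congr_right fun _ =>
    and_congr_left fun _ => forall_congr' fun σ => ?_)
  rw [h.notMem_iff (h.names.mem ha hc).1 hb]

/-- `‖a ∉ b‖` only depends on the `‖a ⊆ c‖` and `‖c ⊆ a‖` with `c` in the domain of `b`. -/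
theorem InNotMem.congr {P P' a b ρ : V}
    (h : ∀ c π, pair c π ∊ b → ∀ σ, (pair (pair a c) σ ∊ P ↔ pair (pair a c) σ ∊ P') ∧
      (pair (pair c a) σ ∊ P ↔ pair (pair c a) σ ∊ P')) :
    𝓐.InNotMem P a b ρ ↔ 𝓐.InNotMem P' a b ρ := by
  refine exists_congr fun c => exists_congr fun t => exists_congr fun t' => exists_congr fun π =>
    and_congr_right fun hc => ?_
  simp only [fun σ => (h c π hc σ).1, fun σ => (h c π hc σ).2]

/-- `‖a ⊆ b‖` only depends on the `‖c ⊆ d‖` and `‖d ⊆ c‖` with `c` and `d` in the domains of `a`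
and `b`. -/
theorem InSub.congr {P P' a b ρ : V}
    (h : ∀ c π, pair c π ∊ a → ∀ d τ, pair d τ ∊ b → ∀ σ,
      (pair (pair c d) σ ∊ P ↔ pair (pair c d) σ ∊ P') ∧
      (pair (pair d c) σ ∊ P ↔ pair (pair d c) σ ∊ P')) :
    𝓐.InSub P a b ρ ↔ 𝓐.InSub P' a b ρ := by
  refine exists_congr fun c => exists_congr fun t => exists_congr fun π =>
    and_congr_right fun hc => and_congr_right fun _ => and_congr_left fun _ =>
    forall_congr' fun σ => ?_
  rw [InNotMem.congr (h c π hc)]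

/-- Two solutions of the recursion agree on their common domain, by induction on `a`, for
`‖a ⊆ b‖` and `‖b ⊆ a‖` together. -/
theorem IsRecursion.unique {T P Q T' P' Q' : V} (h : 𝓐.IsRecursion T P Q)
    (h' : 𝓐.IsRecursion T' P' Q') {a b : V} (ha : a ∊ T) (hb : b ∊ T) (ha' : a ∊ T')
    (hb' : b ∊ T') (ρ : V) : pair (pair a b) ρ ∊ P ↔ pair (pair a b) ρ ∊ P' := by
  have key : a ∊ T → a ∊ T' → ∀ b, b ∊ T → b ∊ T' → ∀ ρ,
      (pair (pair a b) ρ ∊ P ↔ pair (pair a b) ρ ∊ P') ∧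
      (pair (pair b a) ρ ∊ P ↔ pair (pair b a) ρ ∊ P') := by
    refine IsName.induction (𝓐 := 𝓐) (fun a => a ∊ T → a ∊ T' → ∀ b, b ∊ T → b ∊ T' → ∀ ρ,
      (pair (pair a b) ρ ∊ P ↔ pair (pair a b) ρ ∊ P') ∧
      (pair (pair b a) ρ ∊ P ↔ pair (pair b a) ρ ∊ P')) ?_ ⟨T, h.names, ha⟩
    intro a _ ih ha ha' b hb hb' ρ
    rw [h.sub_iff ha hb, h.sub_iff hb ha, h'.sub_iff ha' hb', h'.sub_iff hb' ha']
    have ih' := fun c π hc => ih c π hc (h.names.mem ha hc).1 (h'.names.mem ha' hc).1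
    exact ⟨InSub.congr fun c π hc d τ hd σ =>
        ih' c π hc d (h.names.mem hb hd).1 (h'.names.mem hb' hd).1 σ,
      InSub.congr fun d τ hd c π hc σ =>
        (ih' c π hc d (h.names.mem hb hd).1 (h'.names.mem hb' hd).1 σ).symm⟩
  exact (key ha ha' b hb hb' ρ).1

/-- Two names lie in the domain of a common solution, which computes the falsity values of inclusion
and nonmembership there. -/
theorem exists_common_recursion {a b : V} (ha : 𝓐.IsName a) (hb : 𝓐.IsName b) :
    ∃ T P Q, 𝓐.IsRecursion T P Q ∧ a ∊ T ∧ b ∊ T ∧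
      (∀ c d, c ∊ T → d ∊ T → 𝓐.falsSub c d = {ρ | 𝓐.InSub P c d ρ}) ∧
      (∀ c d, c ∊ T → d ∊ T → 𝓐.falsSub c d = {ρ | pair (pair c d) ρ ∊ P}) ∧
      (∀ c d, c ∊ T → d ∊ T → 𝓐.falsNotMem c d = {ρ | 𝓐.InNotMem P c d ρ}) := by
  obtain ⟨S, hS, haS⟩ := ha
  obtain ⟨T, hT, hbT⟩ := hb
  obtain ⟨U, hU⟩ := exists_union S T
  obtain ⟨P, Q, h⟩ := exists_isRecursion (hS.union hT hU)
  have hsub : ∀ c d, c ∊ U → d ∊ U → 𝓐.falsSub c d = {ρ | pair (pair c d) ρ ∊ P} := by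
    intro c d hc hd
    refine Set.ext fun ρ => ⟨?_, fun hρ => ⟨U, P, Q, h, hc, hd, hρ⟩⟩
    rintro ⟨T', P', Q', h', hc', hd', hρ⟩
    exact (h.unique h' hc hd hc' hd' ρ).2 hρ
  refine ⟨U, P, Q, h, (hU a).2 (Or.inl haS), (hU b).2 (Or.inr hbT), ?_, hsub, ?_⟩
  · intro c d hc hd
    rw [hsub c d hc hd]
    exact Set.ext fun ρ => h.sub_iff hc hd
  · intro c d hc hd
    refine Set.ext fun ρ =>
      ⟨?_, fun hρ => ⟨U, P, Q, h, hc, hd, (h.notMem_iff hc hd).2 hρ⟩⟩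
    rintro ⟨T', P', Q', h', hc', hd', hρ⟩
    refine (InNotMem.congr fun e π he σ => ?_).1 ((h'.notMem_iff hc' hd').1 hρ)
    have he1 := (h.names.mem hd he).1
    have he2 := (h'.names.mem hd' he).1
    exact ⟨h'.unique h hc' he2 hc he1 σ, h'.unique h he2 hc' he1 hc σ⟩

theorem mem_falsNotMem {a b : V} (ha : 𝓐.IsName a) (hb : 𝓐.IsName b) (ρ : V) :
    ρ ∈ 𝓐.falsNotMem a b ↔ ∃ c π, pair c π ∊ b ∧
      ρ ∈ 𝓐.arrow (𝓐.falsSub a c) (𝓐.arrow (𝓐.falsSub c a) {π}) := by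
  obtain ⟨T, P, Q, h, haT, hbT, -, hsub, hnot⟩ := exists_common_recursion ha hb
  rw [hnot a b haT hbT]
  constructor
  · rintro ⟨c, t, t', π, hc, ht, ht', h1, h2, rfl⟩
    have hcT := (h.names.mem hbT hc).1
    refine ⟨c, π, hc, t, _, ⟨ht, ?_⟩, ⟨t', π, ⟨ht', ?_⟩, rfl, rfl⟩, rfl⟩
    · rw [hsub a c haT hcT]; exact h1
    · rw [hsub c a hcT haT]; exact h2
  · rintro ⟨c, π, hc, t, _, ⟨ht, h1⟩, ⟨t', _, ⟨ht', h2⟩, rfl, rfl⟩, rfl⟩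
    have hcT := (h.names.mem hbT hc).1
    rw [hsub a c haT hcT] at h1
    rw [hsub c a hcT haT] at h2
    exact ⟨c, t, t', _, hc, ht, ht', h1, h2, rfl⟩

theorem mem_falsSub {a b : V} (ha : 𝓐.IsName a) (hb : 𝓐.IsName b) (ρ : V) :
    ρ ∈ 𝓐.falsSub a b ↔ ∃ c π, pair c π ∊ a ∧ ρ ∈ 𝓐.arrow (𝓐.falsNotMem c b) {π} := by
  obtain ⟨T, P, Q, h, haT, hbT, hsub, -, hnot⟩ := exists_common_recursion ha hb
  rw [hsub a b haT hbT]
  constructor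
  · rintro ⟨c, t, π, hc, ht, h1, rfl⟩
    refine ⟨c, π, hc, t, π, ⟨ht, ?_⟩, rfl, rfl⟩
    rw [hnot c b (h.names.mem haT hc).1 hbT]
    exact h1
  · rintro ⟨c, _, hc, t, π, ⟨ht, h1⟩, rfl, rfl⟩
    rw [hnot c b (h.names.mem haT hc).1 hbT] at h1
    exact ⟨c, t, _, hc, ht, h1, rfl⟩

/-! ### Recursive names of ordinals -/

instance defPred_isReish (f g : (Fin n → V) → V) [hf : DefFun f] [hg : DefFun g] :
    DefPred fun v => 𝓐.IsReish (f v) (g v) :=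
  DefPred.comp2 (by unfold IsReish IsReishRecursion; infer_instance) hf hg

theorem IsReishRecursion.unique {T f T' f' : V} (h : 𝓐.IsReishRecursion T f)
    (h' : 𝓐.IsReishRecursion T' f') {u : V} (hu : u ∊ T) (hu' : u ∊ T') (v : V) :
    pair u v ∊ f ↔ pair u v ∊ f' := by
  by_contra hcon
  obtain ⟨c, hc⟩ := sep T fun u => u ∊ T' ∧ ∃ v, ¬ (pair u v ∊ f ↔ pair u v ∊ f')
  obtain ⟨m, hm, hmin⟩ := ModelZF.foundation c ⟨u, (hc u).2 ⟨hu, hu', v, hcon⟩⟩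
  obtain ⟨hmT, hmT', v, hv⟩ := (hc m).1 hm
  refine hv ?_
  rw [h.2 m hmT, h'.2 m hmT']
  refine forall_congr' fun p => iff_congr Iff.rfl (exists_congr fun w => exists_congr fun w' =>
    exists_congr fun π => and_congr_right fun hw => and_congr_left fun _ => ?_)
  by_contra hww
  exact hmin w hw ((hc w).2 ⟨h.1 m hmT w hw, h'.1 m hmT' w hw, w', hww⟩)

theorem IsReish.mem_iff {x a : V} (h : 𝓐.IsReish x a) (p : V) :
    p ∊ a ↔ ∃ w w' π, w ∊ x ∧ 𝓐.IsReish w w' ∧ 𝓐.IsStack π ∧ p = pair w' π := by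
  obtain ⟨T, f, hf, hxT, hxa⟩ := h
  rw [(hf.2 x hxT a).1 hxa p]
  refine exists_congr fun w => exists_congr fun w' => exists_congr fun π =>
    and_congr_right fun hw => and_congr_left fun _ => ?_
  have hwT := hf.1 x hxT w hw
  refine ⟨fun h => ⟨T, f, hf, hwT, h⟩, ?_⟩
  rintro ⟨T', f', hf', hwT', h⟩
  exact (hf.unique hf' hwT hwT' w').2 h

theorem IsReish.unique {x a b : V} (ha : 𝓐.IsReish x a) (hb : 𝓐.IsReish x b) : a = b :=
  ext fun p => (ha.mem_iff p).trans (hb.mem_iff p).symm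

theorem IsReish.pair_mem_iff {x a c π : V} (h : 𝓐.IsReish x a) :
    pair c π ∊ a ↔ 𝓐.IsStack π ∧ ∃ w, w ∊ x ∧ 𝓐.IsReish w c := by
  rw [h.mem_iff]
  constructor
  · rintro ⟨w, w', π', hw, hw', hπ, hp⟩
    obtain ⟨rfl, rfl⟩ := pair_inj hp
    exact ⟨hπ, w, hw, hw'⟩
  · rintro ⟨hπ, w, hw, hw'⟩
    exact ⟨w, c, π, hw, hw', hπ, rfl⟩

theorem IsReish.isName {x a : V} (h : 𝓐.IsReish x a) : 𝓐.IsName a := by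
  obtain ⟨T, f, hf, hxT, hxa⟩ := h
  obtain ⟨S, hS⟩ := sep (sUnion (sUnion f)) fun v => ∃ u, u ∊ T ∧ pair u v ∊ f
  refine ⟨S, fun v hv p hp => ?_, (hS a).2 ⟨(mem_sUnion_of_pair_mem hxa).2, x, hxT, hxa⟩⟩
  obtain ⟨-, u, hu, huv⟩ := (hS v).1 hv
  obtain ⟨w, w', π, hw, hw', hπ, rfl⟩ := ((hf.2 u hu v).1 huv p).1 hp
  exact ⟨w', π, (hS w').2 ⟨(mem_sUnion_of_pair_mem hw').2, w, hf.1 u hu w hw, hw'⟩, hπ, rfl⟩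

theorem exists_isReish {α : V} (hα : IsOrd α) : ∃ a, 𝓐.IsReish α a := by
  refine IsOrd.induction (fun α => ∃ a, 𝓐.IsReish α a) ?_ hα
  intro α hα ih
  obtain ⟨stk, hstk⟩ := 𝓐.exists_stackSet
  obtain ⟨f₀, hf₀⟩ := repl α (fun β p => ∃ b, 𝓐.IsReish β b ∧ p = pair β b) (by
    rintro β - _ _ ⟨b, hb, rfl⟩ ⟨b', hb', rfl⟩
    rw [hb.unique hb'])
  obtain ⟨a, ha⟩ := repl (prod α stk)
    (fun x p => ∃ w w' π, x = pair w π ∧ 𝓐.IsReish w w' ∧ p = pair w' π) (by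
      rintro _ - _ _ ⟨w, w', π, rfl, hw, rfl⟩ ⟨u, u', ρ, h, hu, rfl⟩
      obtain ⟨rfl, rfl⟩ := pair_inj h
      rw [hw.unique hu])
  have ha' : ∀ p, p ∊ a ↔ ∃ w w' π, w ∊ α ∧ 𝓐.IsReish w w' ∧ 𝓐.IsStack π ∧ p = pair w' π := by
    intro p
    rw [ha]
    constructor
    · rintro ⟨x, hx, w, w', π, rfl, hw, rfl⟩
      obtain ⟨hwα, hπ⟩ := pair_mem_prod.1 hx
      exact ⟨w, w', π, hwα, hw, (hstk π).1 hπ, rfl⟩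
    · rintro ⟨w, w', π, hwα, hw, hπ, rfl⟩
      exact ⟨_, pair_mem_prod.2 ⟨hwα, (hstk π).2 hπ⟩, w, w', π, rfl, hw, rfl⟩
  obtain ⟨f, hf⟩ := exists_union f₀ (upair (pair α a) (pair α a))
  have hf' : ∀ u v, pair u v ∊ f ↔ (u ∊ α ∧ 𝓐.IsReish u v) ∨ (u = α ∧ v = a) := by
    intro u v
    rw [hf, hf₀, mem_upair, or_self]
    refine or_congr ?_ ⟨pair_inj, by rintro ⟨rfl, rfl⟩; rfl⟩
    constructor
    · rintro ⟨β, hβ, b, hb, h⟩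
      obtain ⟨rfl, rfl⟩ := pair_inj h
      exact ⟨hβ, hb⟩
    · rintro ⟨hu, hv⟩
      exact ⟨u, hu, v, hv, rfl⟩
  have hlt : ∀ u, u ∊ α → ∀ v, pair u v ∊ f ↔ 𝓐.IsReish u v := by
    intro u hu v
    rw [hf']
    refine ⟨?_, fun h => Or.inl ⟨hu, h⟩⟩
    rintro (h | ⟨rfl, -⟩)
    · exact h.2
    · exact (not_mem_self _ hu).elim
  refine ⟨a, succ α, f, ⟨hα.succ.1, fun u hu v => ?_⟩, (mem_succ _ _).2 (Or.inr rfl),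
    (hf' _ _).2 (Or.inr ⟨rfl, rfl⟩)⟩
  have hsub : ∀ w, w ∊ u → w ∊ α := by
    rcases (mem_succ _ _).1 hu with hu | rfl
    · exact fun w hw => hα.1 u hu w hw
    · exact fun w hw => hw
  have hex : ∃ b, pair u b ∊ f ∧ ∀ p, p ∊ b ↔
      ∃ w w' π, w ∊ u ∧ 𝓐.IsReish w w' ∧ 𝓐.IsStack π ∧ p = pair w' π := by
    rcases (mem_succ _ _).1 hu with hu | rfl
    · obtain ⟨b, hb⟩ := ih u hu
      exact ⟨b, (hlt u hu b).2 hb, hb.mem_iff⟩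
    · exact ⟨a, (hf' _ _).2 (Or.inr ⟨rfl, rfl⟩), ha'⟩
  obtain ⟨b, hb, hb'⟩ := hex
  have huv : pair u v ∊ f ↔ v = b := by
    constructor
    · intro h
      rcases (hf' _ _).1 h with ⟨h1, h2⟩ | ⟨rfl, rfl⟩
      · exact h2.unique ((hlt u h1 b).1 hb)
      · rcases (hf' _ _).1 hb with ⟨h1, -⟩ | ⟨-, rfl⟩
        · exact (not_mem_self _ h1).elim
        · rfl
    · rintro rfl
      exact hb
  rw [huv]
  constructor
  · rintro rfl p
    rw [hb']
    exact exists_congr fun w => exists_congr fun w' => exists_congr fun π =>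
      and_congr_right fun hw => and_congr_left fun _ => (hlt w (hsub w hw) w').symm
  · refine fun h => ext fun p => (h p).trans (Iff.trans ?_ (hb' p).symm)
    exact exists_congr fun w => exists_congr fun w' => exists_congr fun π =>
      and_congr_right fun hw => and_congr_left fun _ => hlt w (hsub w hw) w'

/-! ### Typing rules for inclusion and membership -/

instance (a b : V) : 𝓐.IsFalsity (𝓐.falsSub a b) := by
  refine ⟨?_⟩
  rintro _ ⟨T, P, Q, h, ha, hb, hρ⟩
  exact ((h.sub_iff ha hb).1 hρ).isStack h.names ha

instance (a b : V) : 𝓐.IsFalsity (𝓐.falsNotMem a b) := by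
  refine ⟨?_⟩
  rintro _ ⟨T, P, Q, h, ha, hb, hρ⟩
  exact ((h.notMem_iff ha hb).1 hρ).isStack h.names hb

/-- The falsity value of `∀ x, φ(x)`, where `F a = ‖φ(a)‖`. -/
def allN (𝓐 : RealizabilityAlgebra V) (F : V → Set V) : Set V := {π | ∃ a, 𝓐.IsName a ∧ π ∈ F a}

instance (F : V → Set V) [hF : ∀ a, 𝓐.IsFalsity (F a)] : 𝓐.IsFalsity (𝓐.allN F) :=
  ⟨by rintro π ⟨a, -, h⟩; exact (hF a).out π h⟩

instance defSet_allN (F : (Fin n → V) → V → Set V)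
    [hF : DefSet fun w : Fin (n + 1) → V => F (fun i => w i.castSucc) (w (Fin.last n))] :
    DefSet fun v => 𝓐.allN (F v) := by
  refine ⟨?_⟩
  simp only [allN, Set.mem_ofPred_eq]
  have := hF.reindex (fun i => Fin.lastCases (Fin.last (n + 1)) (fun j => j.castSucc.castSucc) i)
  simp only [Fin.lastCases_castSucc, Fin.lastCases_last] at this
  infer_instance

namespace Types

variable {e : ℕ → V} {t : Tm} {a b c π : V} {F : V → Set V}

theorem all_intro [he : 𝓐.ClosedEnv e] (h : ∀ a, 𝓐.IsName a → 𝓐.Types e t (F a)) :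
    𝓐.Types e t (𝓐.allN F) :=
  ⟨isClosedTerm_val e t, by rintro π ⟨a, ha, hπ⟩; exact (h a ha).2 π hπ⟩

theorem all_elim (h : 𝓐.Types e t (𝓐.allN F)) (ha : 𝓐.IsName a) : 𝓐.Types e t (F a) :=
  h.mono fun π hπ => (⟨a, ha, hπ⟩ : π ∈ 𝓐.allN F)

theorem sub_intro [he : 𝓐.ClosedEnv e] (ha : 𝓐.IsName a) (hb : 𝓐.IsName b)
    (h : ∀ c π, pair c π ∊ a → 𝓐.IsName c → 𝓐.IsFalsity {π} →
      𝓐.Types e t (𝓐.arrow (𝓐.falsNotMem c b) {π})) : 𝓐.Types e t (𝓐.falsSub a b) := by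
  refine ⟨isClosedTerm_val e t, fun ρ hρ => ?_⟩
  obtain ⟨c, π, hc, hρ⟩ := (mem_falsSub ha hb ρ).1 hρ
  exact (h c π hc (ha.mem hc).1 (isFalsity_singleton (ha.mem hc).2)).2 ρ hρ

theorem sub_elim (ha : 𝓐.IsName a) (hb : 𝓐.IsName b) (hc : pair c π ∊ a)
    (h : 𝓐.Types e t (𝓐.falsSub a b)) : 𝓐.Types e t (𝓐.arrow (𝓐.falsNotMem c b) {π}) :=
  h.mono fun ρ hρ => (mem_falsSub ha hb ρ).2 ⟨c, π, hc, hρ⟩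

theorem notMem_intro [he : 𝓐.ClosedEnv e] (ha : 𝓐.IsName a) (hb : 𝓐.IsName b)
    (h : ∀ c π, pair c π ∊ b → 𝓐.IsName c → 𝓐.IsFalsity {π} →
      𝓐.Types e t (𝓐.arrow (𝓐.falsSub a c) (𝓐.arrow (𝓐.falsSub c a) {π}))) :
    𝓐.Types e t (𝓐.falsNotMem a b) := by
  refine ⟨isClosedTerm_val e t, fun ρ hρ => ?_⟩
  obtain ⟨c, π, hc, hρ⟩ := (mem_falsNotMem ha hb ρ).1 hρ
  exact (h c π hc (hb.mem hc).1 (isFalsity_singleton (hb.mem hc).2)).2 ρ hρ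

theorem notMem_elim (ha : 𝓐.IsName a) (hb : 𝓐.IsName b) (hc : pair c π ∊ b)
    (h : 𝓐.Types e t (𝓐.falsNotMem a b)) :
    𝓐.Types e t (𝓐.arrow (𝓐.falsSub a c) (𝓐.arrow (𝓐.falsSub c a) {π})) :=
  h.mono fun ρ hρ => (mem_falsNotMem ha hb ρ).2 ⟨c, π, hc, hρ⟩

end Types

theorem isClosedTerm_of_isRealizer {t : V} (h : 𝓐.IsRealizer t) : 𝓐.IsClosedTerm t :=
  IsRealizer.isClosedTerm h

end RealizabilityAlgebra

infixl:70 " ⬩ " => Krivine.Tm.app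

/-! ### The terms of the realizers -/

namespace Tm

/-- Reflexivity of `⊆`: `r = λ t, t r r`. -/
def subRefl : Tm := fix (lam (var 0 ⬩ var 1 ⬩ var 1))

/-- Transitivity of `⊆`: `θ = λ u v t, u (λ p q, v (λ p' q', t (θ p p') (θ q' q)))`. -/
def subTrans : Tm :=
  fix (lam (lam (lam (var 2 ⬩ lam (lam (var 3 ⬩ lam (lam
    (var 4 ⬩ (var 7 ⬩ var 3 ⬩ var 1) ⬩ (var 7 ⬩ var 0 ⬩ var 2)))))))))

/-- Irreflexivity of `∈`: `θ = λ t t', t θ`. -/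
def notMemSelf : Tm := fix (lam (lam (var 1 ⬩ var 2)))

/-- From `x ⊆ b` and `y ∉ b` to `y ∉ x`: `λ s n p q, s (λ p' q', n (trans p p') (trans q' q))`,
where the environment provides `trans`. -/
def notMemOfSub : Tm :=
  lam (lam (lam (lam (var 3 ⬩ lam (lam
    (var 4 ⬩ (var 6 ⬩ var 3 ⬩ var 1) ⬩ (var 6 ⬩ var 0 ⬩ var 2)))))))

/-- `λ s s', s (w s' i)`, where the environment provides `w` (for `notMemOfSub`) and `i` (for
`notMemSelf`). -/
def separating : Tm := lam (lam (var 1 ⬩ (var 2 ⬩ var 0 ⬩ var 3)))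

/-- `λ s s' m l n, m (w s (λ p q, l (w p (w s' n))))`, where the environment provides `w` (for
`notMemOfSub`). -/
def transOfEquiv : Tm :=
  lam (lam (lam (lam (lam (var 2 ⬩ (var 5 ⬩ var 4 ⬩ lam (lam
    (var 3 ⬩ (var 7 ⬩ var 1 ⬩ (var 7 ⬩ var 5 ⬩ var 2))))))))))

/-- Comparability of an ordinal with a recursive name of an ordinal:
`θ = λ o u v w, o (λ a b, w X (λ t, θ o u t u))` with
`X = λ t, cc (λ k, (λ m, θ O t (cc (λ j, a m j v)) (λ p q, k (v q p))) (λ n, k (n r r)))` and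
`O = λ f, f (b m) (λ j, b (a m j))`, where the environment provides `r` (for `subRefl`). -/
def comparable : Tm :=
  fix (lam (lam (lam (lam (var 3 ⬩ lam (lam (var 2 ⬩
    lam (cc ⬩ lam (lam (var 9 ⬩
        lam (var 0 ⬩ (var 4 ⬩ var 1) ⬩ lam (var 5 ⬩ (var 6 ⬩ var 2 ⬩ var 0))) ⬩
        var 2 ⬩ (cc ⬩ lam (var 5 ⬩ var 1 ⬩ var 0 ⬩ var 7)) ⬩
        lam (lam (var 3 ⬩ (var 8 ⬩ var 0 ⬩ var 1)))) ⬩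
      lam (var 1 ⬩ (var 0 ⬩ var 10 ⬩ var 10)))) ⬩
    lam (var 7 ⬩ var 6 ⬩ var 5 ⬩ var 0 ⬩ var 5))))))))

/-- The conjunction of `λ u v w, u (v w)` and `λ u u' v w, u (u' (v w))`, for the `ε`-transitivity
of an `ε`-ordinal and of its elements. -/
def ordEps : Tm :=
  lam (var 0 ⬩ lam (lam (lam (var 2 ⬩ (var 1 ⬩ var 0)))) ⬩
    lam (lam (lam (lam (var 3 ⬩ (var 2 ⬩ (var 1 ⬩ var 0)))))))

/-- `λ t, t r r`, where the environment provides `r` (for `subRefl`). -/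
def subR : Tm := lam (var 0 ⬩ var 1 ⬩ var 1)

end Tm

namespace RealizabilityAlgebra

variable {V : Type*} [setLang.Structure V] [ModelZF V] {𝓐 : RealizabilityAlgebra V} {n : ℕ}

/-! ### Ordinals in the realizability interpretation -/

instance : 𝓐.ClosedEnv nilEnv := ⟨fun _ => 𝓐.isClosedTerm_cc⟩

/-- The falsity value of `a ∈ b`. -/
abbrev falsMem (𝓐 : RealizabilityAlgebra V) (a b : V) : Set V :=
  𝓐.arrow (𝓐.falsNotMem a b) 𝓐.falsBot

/-- The falsity value of the `∈`-transitivity of `a`. -/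
def falsTrans (𝓐 : RealizabilityAlgebra V) (a : V) : Set V :=
  𝓐.allN fun y => 𝓐.arrow (𝓐.falsMem y a) <|
    𝓐.allN fun z => 𝓐.arrow (𝓐.falsMem z y) (𝓐.falsMem z a)

/-- The falsity value of the `∈`-transitivity of all elements of `a`. -/
def falsAllTrans (𝓐 : RealizabilityAlgebra V) (a : V) : Set V :=
  𝓐.allN fun y => 𝓐.arrow (𝓐.falsMem y a) (𝓐.falsTrans y)

/-- The falsity value of the conjunction of two formulas. -/
abbrev falsAnd (𝓐 : RealizabilityAlgebra V) (F G : Set V) : Set V :=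
  𝓐.arrow (𝓐.arrow F (𝓐.arrow G 𝓐.falsBot)) 𝓐.falsBot

/-- The falsity value of `Ord_∈(a)`. -/
abbrev falsOrd (𝓐 : RealizabilityAlgebra V) (a : V) : Set V :=
  𝓐.falsAnd (𝓐.falsTrans a) (𝓐.falsAllTrans a)

/-- The falsity value of `x ⊆ b → b ⊆ x → ⊥`. -/
abbrev falsNotEquiv (𝓐 : RealizabilityAlgebra V) (x b : V) : Set V :=
  𝓐.arrow (𝓐.falsSub x b) (𝓐.arrow (𝓐.falsSub b x) 𝓐.falsBot)

/-- The falsity value of "if `x` is an ordinal, then `x ∈ b` or `b ∈ x` or `x` is equal to `b`". -/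
abbrev falsComparable (𝓐 : RealizabilityAlgebra V) (b x : V) : Set V :=
  𝓐.arrow (𝓐.falsOrd x) <| 𝓐.arrow (𝓐.falsNotMem x b) <| 𝓐.arrow (𝓐.falsNotMem b x) <|
    𝓐.arrow (𝓐.falsNotEquiv x b) 𝓐.falsBot

instance (a : V) : 𝓐.IsFalsity (𝓐.falsTrans a) := by unfold falsTrans; infer_instance

instance defSet_falsTrans (f : (Fin n → V) → V) [hf : DefFun f] :
    DefSet fun v => 𝓐.falsTrans (f v) :=
  ⟨DefPred.comp2 (P := fun a ρ => ρ ∈ 𝓐.falsTrans a) (by unfold falsTrans; infer_instance)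
    (hf.comp _ fun i => defFun_proj i.castSucc) (defFun_proj _)⟩

instance defSet_falsAllTrans (f : (Fin n → V) → V) [hf : DefFun f] :
    DefSet fun v => 𝓐.falsAllTrans (f v) :=
  ⟨DefPred.comp2 (P := fun a ρ => ρ ∈ 𝓐.falsAllTrans a) (by unfold falsAllTrans; infer_instance)
    (hf.comp _ fun i => defFun_proj i.castSucc) (defFun_proj _)⟩

namespace Types

variable {e : ℕ → V} [he : 𝓐.ClosedEnv e] {a b c x y β γ g : V}

omit he in
theorem allTrans_app {t m : Tm} (ht : 𝓐.Types e t (𝓐.falsAllTrans a)) (hy : 𝓐.IsName y)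
    (hm : 𝓐.Types e m (𝓐.falsMem y a)) : 𝓐.Types e (t ⬩ m) (𝓐.falsTrans y) :=
  app (all_elim (F := fun y => 𝓐.arrow (𝓐.falsMem y a) (𝓐.falsTrans y)) ht hy) hm

omit he in
theorem trans_app {t m j : Tm} (ht : 𝓐.Types e t (𝓐.falsTrans a)) (hy : 𝓐.IsName y)
    (hx : 𝓐.IsName x) (hm : 𝓐.Types e m (𝓐.falsMem y a)) (hj : 𝓐.Types e j (𝓐.falsMem x y)) :
    𝓐.Types e (t ⬩ m ⬩ j) (𝓐.falsMem x a) :=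
  app (all_elim (F := fun x => 𝓐.arrow (𝓐.falsMem x y) (𝓐.falsMem x a)) (app (all_elim
    (F := fun y => 𝓐.arrow (𝓐.falsMem y a) (𝓐.allN fun x =>
      𝓐.arrow (𝓐.falsMem x y) (𝓐.falsMem x a))) ht hy) hm) hx) hj

/-- By induction on `a`. -/
theorem subRefl (ha : 𝓐.IsName a) : 𝓐.Types e .subRefl (𝓐.falsSub a a) := by
  refine IsName.induction (𝓐 := 𝓐)
    (fun a => Tm.subRefl.val 0 e ∈ 𝓐.truth (𝓐.falsSub a a)) ?_ ha
  intro a ha ih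
  refine Types.fix fun _ => ?_
  refine sub_intro ha ha fun c π hc hc' _ => lam fun t ht _ => ?_
  have hr := ih c π hc
  exact app (app ((var 0 ht).notMem_elim hc' ha hc) (var 1 hr)) (var 1 hr)

/-- Induction on `b`, for all `a` and `c`. -/
theorem subTrans (ha : 𝓐.IsName a) (hb : 𝓐.IsName b) (hc : 𝓐.IsName c) :
    𝓐.Types e .subTrans
      (𝓐.arrow (𝓐.falsSub a b) (𝓐.arrow (𝓐.falsSub b c) (𝓐.falsSub a c))) := by
  suffices h : ∀ a c, 𝓐.IsName a → 𝓐.IsName c → Tm.subTrans.val 0 e ∈ 𝓐.truth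
      (𝓐.arrow (𝓐.falsSub a b) (𝓐.arrow (𝓐.falsSub b c) (𝓐.falsSub a c))) from h a c ha hc
  clear ha hc
  refine IsName.induction (𝓐 := 𝓐) (fun b => ∀ a c, 𝓐.IsName a → 𝓐.IsName c →
    Tm.subTrans.val 0 e ∈ 𝓐.truth
      (𝓐.arrow (𝓐.falsSub a b) (𝓐.arrow (𝓐.falsSub b c) (𝓐.falsSub a c)))) ?_ hb
  intro b hb ih a c ha hc
  refine Types.fix fun _ => ?_
  refine lam fun u hu _ => lam fun v hv _ => sub_intro ha hc fun d π hd hd' _ =>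
    lam fun t ht _ => app ((var 2 hu).sub_elim ha hb hd) ?_
  refine notMem_intro hd' hb fun i σ hi hi' _ => lam fun p hp _ => lam fun q hq _ =>
    app ((var 3 hv).sub_elim hb hc hi) ?_
  refine notMem_intro hi' hc fun j τ hj hj' _ => lam fun p' hp' _ => lam fun q' hq' _ =>
    app (app ((var 4 ht).notMem_elim hd' hc hj) ?_) ?_
  · exact app (app (var 7 (ih i σ hi d j hd' hj')) (var 3 hp)) (var 1 hp')
  · exact app (app (var 7 (ih i σ hi j d hj' hd')) (var 0 hq')) (var 2 hq)

/-- By induction on `γ`: if `reish γ` is equal to its element `reish δ`, then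
`reish δ ∈ reish δ`. -/
theorem notMemSelf (hγ : IsOrd γ) (hg : 𝓐.IsReish γ g) :
    𝓐.Types e .notMemSelf (𝓐.falsNotMem g g) := by
  suffices h : ∀ g, 𝓐.IsReish γ g → Tm.notMemSelf.val 0 e ∈ 𝓐.truth (𝓐.falsNotMem g g) from
    h g hg
  clear hg
  refine IsOrd.induction (fun γ => ∀ g, 𝓐.IsReish γ g →
    Tm.notMemSelf.val 0 e ∈ 𝓐.truth (𝓐.falsNotMem g g)) ?_ hγ
  intro γ _ ih g hg
  refine Types.fix fun _ => ?_
  refine notMem_intro hg.isName hg.isName fun d π hd hd' _ =>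
    lam fun t ht _ => lam fun t' _ _ => app ((var 1 ht).sub_elim hg.isName hd' hd) (var 2 ?_)
  obtain ⟨-, δ, hδ, hd⟩ := hg.pair_mem_iff.1 hd
  exact ih δ hδ d hd

/-- By the transitivity of `⊆`, which the environment provides. -/
theorem notMemOfSub (hx : 𝓐.IsName x) (hb : 𝓐.IsName b) (hy : 𝓐.IsName y)
    (h : ∀ a b c, 𝓐.IsName a → 𝓐.IsName b → 𝓐.IsName c → e 0 ∈ 𝓐.truth
      (𝓐.arrow (𝓐.falsSub a b) (𝓐.arrow (𝓐.falsSub b c) (𝓐.falsSub a c)))) :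
    𝓐.Types e .notMemOfSub
      (𝓐.arrow (𝓐.falsSub x b) (𝓐.arrow (𝓐.falsNotMem y b) (𝓐.falsNotMem y x))) := by
  refine lam fun s hs _ => lam fun n hn _ => notMem_intro hy hx fun c π hc hc' _ =>
    lam fun p hp _ => lam fun q hq _ => app ((var 3 hs).sub_elim hx hb hc) ?_
  refine notMem_intro hc' hb fun d ρ hd hd' _ => lam fun p' hp' _ => lam fun q' hq' _ =>
    app (app ((var 4 hn).notMem_elim hy hb hd) ?_) ?_
  · exact app (app (var 6 (h y c d hy hc' hd')) (var 3 hp)) (var 1 hp')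
  · exact app (app (var 6 (h d c y hd' hc' hy)) (var 0 hq')) (var 2 hq)

end Types

/-- `w` realizes `x ⊆ b → y ∉ b → y ∉ x` for all names `x`, `b` and `y`. -/
def SubRule (𝓐 : RealizabilityAlgebra V) (w : V) : Prop :=
  ∀ x b y, 𝓐.IsName x → 𝓐.IsName b → 𝓐.IsName y → w ∈ 𝓐.truth
    (𝓐.arrow (𝓐.falsSub x b) (𝓐.arrow (𝓐.falsNotMem y b) (𝓐.falsNotMem y x)))

theorem IsReish.mono {γ β g b : V} (hβ : IsOrd β) (hg : 𝓐.IsReish γ g) (hb : 𝓐.IsReish β b)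
    (h : γ ∊ β) {c π : V} (hc : pair c π ∊ g) : pair c π ∊ b := by
  obtain ⟨hπ, δ, hδ, hc⟩ := hg.pair_mem_iff.1 hc
  exact hb.pair_mem_iff.2 ⟨hπ, δ, hβ.1 γ h δ hδ, hc⟩

theorem falsNotMem_mono {γ β g b x : V} (hβ : IsOrd β) (hg : 𝓐.IsReish γ g)
    (hb : 𝓐.IsReish β b) (h : γ ∊ β) (hx : 𝓐.IsName x) :
    𝓐.falsNotMem x g ⊆ 𝓐.falsNotMem x b := by
  intro ρ hρ
  obtain ⟨c, π, hc, hρ⟩ := (mem_falsNotMem hx hg.isName ρ).1 hρ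
  exact (mem_falsNotMem hx hb.isName ρ).2 ⟨c, π, hg.mono hβ hb h hc, hρ⟩

theorem falsNotEquiv_subset {γ β g b x : V} (hg : 𝓐.IsReish γ g)
    (hb : 𝓐.IsReish β b) (h : γ ∊ β) (hx : 𝓐.IsName x) :
    𝓐.falsNotEquiv x g ⊆ 𝓐.falsNotMem x b := by
  rintro _ ⟨t, _, ht, ⟨t', π, ht', hπ, rfl⟩, rfl⟩
  exact (mem_falsNotMem hx hb.isName _).2 ⟨g, π, hb.pair_mem_iff.2 ⟨hπ, γ, h, hg⟩,
    t, _, ht, ⟨t', π, ht', rfl, rfl⟩, rfl⟩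

namespace Types

variable {e : ℕ → V} [he : 𝓐.ClosedEnv e] {b c x β γ g : V}

omit he in
/-- If `s` realizes `reish β ⊆ c` and `s'` realizes `c ⊆ reish γ` with `γ ∈ β`, then a fixed term
applied to `s` and `s'` realizes `⊥`, since `reish γ ∈ reish β` and `reish γ ∉ reish γ`. -/
theorem separating {s s' : V} (hγ : IsOrd γ) (hg : 𝓐.IsReish γ g)
    (hb : 𝓐.IsReish β b) (h : γ ∊ β) (hc : 𝓐.IsName c) (h0 : 𝓐.SubRule (e 0))
    (h1 : ∀ γ g, IsOrd γ → 𝓐.IsReish γ g → e 1 ∈ 𝓐.truth (𝓐.falsNotMem g g))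
    (hs : s ∈ 𝓐.truth (𝓐.falsSub b c)) (hs' : s' ∈ 𝓐.truth (𝓐.falsSub c g)) :
    𝓐.Types (cons s' (cons s e)) (.var 1 ⬩ (.var 2 ⬩ .var 0 ⬩ .var 3)) 𝓐.falsBot := by
  have : ∀ π, 𝓐.IsStack π →
      𝓐.Types (cons s' (cons s e)) (.var 1 ⬩ (.var 2 ⬩ .var 0 ⬩ .var 3)) {π} := fun π hπ => by
    have := isFalsity_singleton hπ
    refine app ((var 1 hs).sub_elim hb.isName hc (hb.pair_mem_iff.2 ⟨hπ, γ, h, hg⟩)) ?_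
    exact app (app (var 2 (h0 c g g hc hg.isName hg.isName)) (var 0 hs')) (var 3 (h1 γ g hγ hg))
  obtain ⟨π, hπ⟩ := 𝓐.exists_isStack
  exact ⟨(this π hπ).1, fun π hπ => (this π hπ).2 π rfl⟩

/-- If `x` is equal to an ordinal `reish β`, then `x` is transitive. -/
theorem transOfEquiv (hβ : IsOrd β) (hb : 𝓐.IsReish β b) (hx : 𝓐.IsName x)
    (h0 : 𝓐.SubRule (e 0)) :
    𝓐.Types e .transOfEquiv
      (𝓐.arrow (𝓐.falsSub x b) (𝓐.arrow (𝓐.falsSub b x) (𝓐.falsTrans x))) := by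
  refine lam fun s hs _ => lam fun s' hs' _ => all_intro fun y hy => lam fun m hm _ =>
    all_intro fun z hz => lam fun l hl _ => lam fun n hn _ => app (var 2 hm) ?_
  refine app (app (var 5 (h0 x b y hx hb.isName hy)) (var 4 hs)) ?_
  refine notMem_intro hy hb.isName fun g ρ hgb hg' _ => lam fun p hp _ => lam fun q hq _ => ?_
  obtain ⟨-, γ, hγ, hg⟩ := hb.pair_mem_iff.1 hgb
  refine exfalso (app (var 3 hl) (app (app (var 7 (h0 y g z hy hg' hz)) (var 1 hp)) ?_))
  refine mono (falsNotMem_mono hβ hg hb hγ hz) ?_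
  exact app (app (var 7 (h0 b x z hb.isName hx hz)) (var 5 hs')) (var 2 hn)

/-- Comparability, by induction on `β` and, for fixed `β`, on `x`. If an element `c` of `x` is
comparable with `reish β` and `reish β ∉ x`, then `c ∈ reish β`; if `γ ∈ β` is such that `reish γ`
is comparable with `x` and `x ∉ reish β`, then `reish γ ∈ x`. -/
theorem comparable (hβ : IsOrd β) (hb : 𝓐.IsReish β b) (hx : 𝓐.IsName x)
    (h0 : ∀ a, 𝓐.IsName a → e 0 ∈ 𝓐.truth (𝓐.falsSub a a)) :
    𝓐.Types e .comparable (𝓐.falsComparable b x) := by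
  suffices h : ∀ b, 𝓐.IsReish β b → ∀ x, 𝓐.IsName x →
      Tm.comparable.val 0 e ∈ 𝓐.truth (𝓐.falsComparable b x) from h b hb x hx
  clear hb hx
  refine IsOrd.induction (fun β => ∀ b, 𝓐.IsReish β b → ∀ x, 𝓐.IsName x →
    Tm.comparable.val 0 e ∈ 𝓐.truth (𝓐.falsComparable b x)) ?_ hβ
  intro β hβ ihβ b hb x hx
  refine IsName.induction (𝓐 := 𝓐)
    (fun x => Tm.comparable.val 0 e ∈ 𝓐.truth (𝓐.falsComparable b x)) ?_ hx
  intro x hx ihx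
  have hb' := hb.isName
  refine Types.fix fun _ => ?_
  refine lam fun o ho _ => lam fun u hu _ => lam fun v hv _ => lam fun w hw _ =>
    app (var 3 ho) (lam fun a ha _ => lam fun b₂ hb₂ _ => app (app (var 2 hw) ?_) ?_)
  -- `x ⊆ b`: for `c ε x` with `c ∉ b`, comparability of `b` and `c` is applied; the bound variable
  -- `m` realizes `c ∈ x`, which makes `c` an ordinal and turns `b ∈ c` and `c = b` into `b ∈ x`.
  · refine sub_intro hx hb' fun c σ hc hc' _ => lam fun t ht _ => callcc (G := 𝓐.falsBot) ?_
    refine lam fun k hk _ => app (F := 𝓐.falsMem c x) (lam fun m hm _ => exfalso ?_) ?_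
    · refine app (app (app (app (var 9 (ihx c σ hc)) ?_) (var 2 ht)) ?_) ?_
      · refine lam fun f hf _ => app (app (var 0 hf) ?_) ?_
        · exact allTrans_app (var 4 hb₂) hc' (var 1 hm)
        · refine all_intro fun y hy => lam fun j hj _ => allTrans_app (var 5 hb₂) hy ?_
          exact trans_app (var 6 ha) hc' hy (var 2 hm) (var 0 hj)
      · refine callcc (G := 𝓐.falsBot) (lam fun j hj _ => exfalso ?_)
        exact app (trans_app (var 5 ha) hc' hb' (var 1 hm) (var 0 hj)) (var 7 hv)
      · refine lam fun p hp _ => lam fun q hq _ => app (var 3 hk) ?_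
        exact app (app ((var 8 hv).notMem_elim hb' hx hc) (var 0 hq)) (var 1 hp)
    · refine lam fun n hn _ => app (var 1 hk) ?_
      exact app (app ((var 0 hn).notMem_elim hc' hx hc) (var 10 (h0 c hc'))) (var 10 (h0 c hc'))
  -- `b ⊆ x`: for `g = reish γ` with `γ ∈ β` and `g ∉ x`, comparability of `g` and `x` is applied.
  · refine sub_intro hb' hx fun g ρ hg hg' _ => lam fun t ht _ => exfalso ?_
    obtain ⟨-, γ, hγ, hg⟩ := hb.pair_mem_iff.1 hg
    exact app (app (app (app (var 7 (ihβ γ hγ g hg x hx)) (var 6 ho))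
      (mono (falsNotMem_mono hβ hg hb hγ hx) (var 5 hu))) (var 0 ht))
      (mono (falsNotEquiv_subset hg hb hγ hx) (var 5 hu))

end Types

/-! ### A proper class of recursive names -/

/-- Every name `a` omits some `reish β`, with a realizer that does not depend on `a`. For each name
`c` in the domain of `a` and all `s`, `s'`, there is at most one `β` that is the only ordinal for
which `s` realizes `reish β ⊆ c` and `s'` realizes `c ⊆ reish β`; by replacement, some ordinal `β`
is not obtained in this way. If `s` and `s'` are realizers as above for this `β`, then they are so
for two different ordinals, so that `separating` applies. -/
theorem exists_types_separating {e : ℕ → V} [he : 𝓐.ClosedEnv e] (h0 : 𝓐.SubRule (e 0))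
    (h1 : ∀ γ g, IsOrd γ → 𝓐.IsReish γ g → e 1 ∈ 𝓐.truth (𝓐.falsNotMem g g)) {a : V}
    (ha : 𝓐.IsName a) :
    ∃ β b, IsOrd β ∧ 𝓐.IsReish β b ∧ 𝓐.Types e .separating (𝓐.falsNotMem b a) := by
  obtain ⟨tms, htms⟩ := 𝓐.exists_termSet
  let U : V → V → V → V → Prop := fun c s s' β => IsOrd β ∧ ∃ b, 𝓐.IsReish β b ∧
    s ∈ 𝓐.truth (𝓐.falsSub b c) ∧ s' ∈ 𝓐.truth (𝓐.falsSub c b)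
  have hdef : DefPred fun v : Fin 2 → V => ∃ c s s', v 0 = pair c (pair s s') ∧
      U c s s' (v 1) ∧ ∀ γ, U c s s' γ → γ = v 1 := by
    simp only [U]; infer_instance
  obtain ⟨Y, hY⟩ := repl (prod (sUnion (sUnion a)) (prod tms tms))
    (fun w β => ∃ c s s', w = pair c (pair s s') ∧ U c s s' β ∧ ∀ γ, U c s s' γ → γ = β) (by
      rintro _ - β γ ⟨c, s, s', rfl, hβ, -⟩ ⟨c₂, s₂, s₂', h, -, hγ⟩
      obtain ⟨rfl, h'⟩ := pair_inj h
      obtain ⟨rfl, rfl⟩ := pair_inj h'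
      exact hγ β hβ)
  obtain ⟨β, hβ, hβY⟩ := exists_isOrd_not_mem Y
  obtain ⟨b, hb⟩ := exists_isReish (𝓐 := 𝓐) hβ
  refine ⟨β, b, hβ, hb, Types.notMem_intro hb.isName ha fun c π hc hc' _ =>
    Types.lam fun s hs _ => Types.lam fun s' hs' _ => Types.exfalso ?_⟩
  obtain ⟨γ, ⟨hγ, g, hg, hgs, hgs'⟩, hne⟩ : ∃ γ, U c s s' γ ∧ γ ≠ β := by
    by_contra! hcon
    exact hβY ((hY β).2 ⟨_, pair_mem_prod.2 ⟨(mem_sUnion_of_pair_mem hc).1,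
      pair_mem_prod.2 ⟨(htms s).2 hs.1, (htms s').2 hs'.1⟩⟩, c, s, s', rfl,
      ⟨hβ, b, hb, hs, hs'⟩, hcon⟩)
  rcases hγ.trichotomy β hβ with h | h | h
  · exact Types.separating hγ hg hb h hc' h0 h1 hs hgs'
  · exact (hne h).elim
  · exact Types.separating hβ hb hg h hc' h0 h1 hgs hs'

/-- The environment provides realizers of the facts on which the following realizers rely. -/
structure IsLibrary (𝓐 : RealizabilityAlgebra V) (e : ℕ → V) : Prop where
  realizer : ∀ i, 𝓐.IsRealizer (e i)
  refl : ∀ a, 𝓐.IsName a → e 0 ∈ 𝓐.truth (𝓐.falsSub a a)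
  sub : 𝓐.SubRule (e 1)
  trans : ∀ β b x, IsOrd β → 𝓐.IsReish β b → 𝓐.IsName x → e 2 ∈ 𝓐.truth
    (𝓐.arrow (𝓐.falsSub x b) (𝓐.arrow (𝓐.falsSub b x) (𝓐.falsTrans x)))
  comparable : ∀ β b x, IsOrd β → 𝓐.IsReish β b → 𝓐.IsName x →
    e 3 ∈ 𝓐.truth (𝓐.falsComparable b x)
  separating : ∀ a, 𝓐.IsName a →
    ∃ β b, IsOrd β ∧ 𝓐.IsReish β b ∧ e 4 ∈ 𝓐.truth (𝓐.falsNotMem b a)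

theorem exists_isLibrary : ∃ e, 𝓐.IsLibrary e := by
  have hcc : 𝓐.IsRealizer tCC := fun S hS => hS.cc _ isNat_empty
  have hnil : ∀ i, 𝓐.IsRealizer (nilEnv i) := fun _ => hcc
  have hcons : ∀ {s : V} {e : ℕ → V}, 𝓐.IsRealizer s → (∀ i, 𝓐.IsRealizer (e i)) →
      ∀ i, 𝓐.IsRealizer (cons s e i) := fun hs he i => by cases i; exacts [hs, he _]
  have hclosed : ∀ {e : ℕ → V}, (∀ i, 𝓐.IsRealizer (e i)) → 𝓐.ClosedEnv e :=
    fun he => ⟨fun i => isClosedTerm_of_isRealizer (he i)⟩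
  have hval : ∀ {e : ℕ → V} (t : Tm), (∀ i, 𝓐.IsRealizer (e i)) → 𝓐.IsRealizer (t.val 0 e) :=
    fun t he => t.isRealizer_val he
  let r : V := Tm.subRefl.val 0 nilEnv
  have e1 := hcons (hval .subTrans hnil) hnil
  let w : V := Tm.notMemOfSub.val 0 (cons (Tm.subTrans.val 0 nilEnv) nilEnv)
  have hw : 𝓐.SubRule w := fun x b y hx hb hy =>
    have := hclosed e1
    Types.notMemOfSub hx hb hy fun a b c ha hb hc => Types.subTrans ha hb hc
  have e2 := hcons (hval .notMemOfSub e1) hnil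
  have e3 := hcons (hval .notMemOfSub e1) (hcons (hval .notMemSelf hnil) hnil)
  have e4 := hcons (hval .subRefl hnil) hnil
  refine ⟨cons r (cons w (cons (Tm.transOfEquiv.val 0 (cons w nilEnv))
    (cons (Tm.comparable.val 0 (cons r nilEnv)) (cons (Tm.separating.val 0
      (cons w (cons (Tm.notMemSelf.val 0 nilEnv) nilEnv))) nilEnv)))), ?_, ?_, hw, ?_, ?_, ?_⟩
  · exact hcons (hval _ hnil) (hcons (hval _ e1) (hcons (hval _ e2) (hcons (hval _ e4)
      (hcons (hval _ e3) hnil))))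
  · exact fun a ha => Types.subRefl ha
  · have := hclosed e2
    exact fun β b x hβ hb hx => Types.transOfEquiv hβ hb hx hw
  · have := hclosed e4
    exact fun β b x hβ hb hx => Types.comparable hβ hb hx fun a ha => Types.subRefl ha
  · have := hclosed e3
    exact fun a ha => exists_types_separating hw (fun γ g hγ hg => Types.notMemSelf hγ hg) ha

/-- The falsity value of `x ∉ R`, for the class `R` of the recursive names of ordinals. -/
abbrev falsNotMemR (𝓐 : RealizabilityAlgebra V) (x : V) : Set V :=
  𝓐.falsNotMemC (𝓐.ReishOrd ()) x

theorem mem_falsNotMemR {x ρ : V} : ρ ∈ 𝓐.falsNotMemR x ↔ ∃ β b π, IsOrd β ∧ 𝓐.IsReish β b ∧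
    𝓐.IsStack π ∧ ρ ∈ 𝓐.arrow (𝓐.falsSub x b) (𝓐.arrow (𝓐.falsSub b x) {π}) := by
  constructor
  · rintro ⟨c, t, t', π, ⟨hπ, β, hβ, hc⟩, ht, ht', rfl⟩
    exact ⟨β, c, π, hβ, hc, hπ, t, _, ht, ⟨t', π, ht', rfl, rfl⟩, rfl⟩
  · rintro ⟨β, b, π, hβ, hb, hπ, t, _, ht, ⟨t', _, ht', rfl, rfl⟩, rfl⟩
    exact ⟨b, t, t', _, ⟨hπ, β, hβ, hb⟩, ht, ht', rfl⟩

theorem falsNotMem_subset_falsNotMemR {β b x : V} (hβ : IsOrd β) (hb : 𝓐.IsReish β b)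
    (hx : 𝓐.IsName x) : 𝓐.falsNotMem x b ⊆ 𝓐.falsNotMemR x := by
  intro ρ hρ
  obtain ⟨c, π, hc, hρ⟩ := (mem_falsNotMem hx hb.isName ρ).1 hρ
  obtain ⟨hπ, γ, hγ, hc⟩ := hb.pair_mem_iff.1 hc
  exact mem_falsNotMemR.2 ⟨γ, c, π, hβ.mem hγ, hc, hπ, hρ⟩

theorem falsNotEquiv_subset_falsNotMemR {β b x : V} (hβ : IsOrd β) (hb : 𝓐.IsReish β b) :
    𝓐.falsNotEquiv x b ⊆ 𝓐.falsNotMemR x := by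
  rintro _ ⟨t, _, ht, ⟨t', π, ht', hπ, rfl⟩, rfl⟩
  exact mem_falsNotMemR.2 ⟨β, b, π, hβ, hb, hπ, t, _, ht, ⟨t', π, ht', rfl, rfl⟩, rfl⟩

/-- The falsity value of `x ∈ R`. -/
abbrev falsMemR (𝓐 : RealizabilityAlgebra V) (x : V) : Set V :=
  𝓐.arrow (𝓐.falsNotMemR x) 𝓐.falsBot

/-- The falsity value of `a notε b`. -/
def falsNotEps (𝓐 : RealizabilityAlgebra V) (a b : V) : Set V := {π | 𝓐.IsStack π ∧ pair a π ∊ b}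

/-- The falsity value of `a ε b`. -/
abbrev falsEps (𝓐 : RealizabilityAlgebra V) (a b : V) : Set V :=
  𝓐.arrow (𝓐.falsNotEps a b) 𝓐.falsBot

/-- The falsity value of the `ε`-transitivity of `a`. -/
def falsTransEps (𝓐 : RealizabilityAlgebra V) (a : V) : Set V :=
  𝓐.allN fun y => 𝓐.arrow (𝓐.falsEps y a) <|
    𝓐.allN fun z => 𝓐.arrow (𝓐.falsEps z y) (𝓐.falsEps z a)

instance (a : V) : 𝓐.IsFalsity (𝓐.falsTransEps a) := by unfold falsTransEps; infer_instance

/-! ### Ordinals and the class `R` -/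

namespace Types

variable {e : ℕ → V}

theorem notMemR_intro [he : 𝓐.ClosedEnv e] {t : Tm} {x : V}
    (h : ∀ β b π, IsOrd β → 𝓐.IsReish β b → 𝓐.IsFalsity {π} →
      𝓐.Types e t (𝓐.arrow (𝓐.falsSub x b) (𝓐.arrow (𝓐.falsSub b x) {π}))) :
    𝓐.Types e t (𝓐.falsNotMemR x) := by
  refine ⟨isClosedTerm_val e t, fun ρ hρ => ?_⟩
  obtain ⟨β, b, π, hβ, hb, hπ, hρ⟩ := mem_falsNotMemR.1 hρ
  exact (h β b π hβ hb (isFalsity_singleton hπ)).2 ρ hρ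

theorem notMemR_elim {t : Tm} {x β b π : V} (hβ : IsOrd β) (hb : 𝓐.IsReish β b)
    (hπ : 𝓐.IsStack π) (h : 𝓐.Types e t (𝓐.falsNotMemR x)) :
    𝓐.Types e t (𝓐.arrow (𝓐.falsSub x b) (𝓐.arrow (𝓐.falsSub b x) {π})) :=
  h.mono fun _ hρ => mem_falsNotMemR.2 ⟨β, b, π, hβ, hb, hπ, hρ⟩

/-- Ordinals belong to `R`: an ordinal `x` is compared with some `reish β ∉ x`, and each of the two
remaining cases contradicts `x ∉ R`, because `‖x ∉ reish β‖` and `‖x ⊆ reish β → reish β ⊆ x → ⊥‖`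
are contained in `‖x ∉ R‖`. -/
theorem memR_of_ord [he : 𝓐.ClosedEnv e] (hl : 𝓐.IsLibrary e) :
    𝓐.Types e (.lam (.lam (.var 5 ⬩ .var 1 ⬩ .var 0 ⬩ .var 6 ⬩ .var 0)))
      (𝓐.allN fun x => 𝓐.arrow (𝓐.falsOrd x) (𝓐.falsMemR x)) := by
  refine all_intro fun x hx => lam fun o ho _ => lam fun u hu _ => ?_
  obtain ⟨β, b, hβ, hb, ht⟩ := hl.separating x hx
  exact app (app (app (app (var 5 (hl.comparable β b x hβ hb hx)) (var 1 ho))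
    (mono (falsNotMem_subset_falsNotMemR hβ hb hx) (var 0 hu))) (var 6 ht))
    (mono (falsNotEquiv_subset_falsNotMemR hβ hb) (var 0 hu))

/-- The elements of `R` are ordinals: membership in `R` yields an ordinal `reish β` that is equal to
`x`. -/
theorem ord_of_memR [he : 𝓐.ClosedEnv e] (hl : 𝓐.IsLibrary e) :
    𝓐.Types e (.lam (.lam (.var 1 ⬩ .lam (.lam (.var 2 ⬩ (.var 6 ⬩ .var 1 ⬩ .var 0) ⬩
      .lam (.lam (.lam (.lam (.var 3 ⬩ (.var 9 ⬩ .var 5 ⬩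
        .lam (.lam (.var 12 ⬩ .var 1 ⬩ .var 0 ⬩ .var 4 ⬩ .var 3 ⬩ .var 2))))))))))))
      (𝓐.allN fun x => 𝓐.arrow (𝓐.falsMemR x) (𝓐.falsOrd x)) := by
  refine all_intro fun x hx => lam fun u hu _ => lam fun f hf _ => app (var 1 hu) ?_
  refine notMemR_intro fun β b π hβ hb _ => lam fun s hs _ => lam fun s' hs' _ => exfalso ?_
  have hb' := hb.isName
  refine app (app (var 2 hf)
    (app (app (var 6 (hl.trans β b x hβ hb hx)) (var 1 hs)) (var 0 hs'))) ?_
  refine all_intro fun y hy => lam fun j hj _ => all_intro fun y₁ hy₁ => lam fun m hm _ =>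
    all_intro fun z hz => lam fun l hl' _ => lam fun n hn _ => app (var 3 hj) ?_
  refine app (app (var 9 (hl.sub x b y hx hb' hy)) (var 5 hs)) ?_
  refine notMem_intro hy hb' fun g ρ hg hg' _ => lam fun p hp _ => lam fun q hq _ => exfalso ?_
  obtain ⟨-, γ, hγ, hg⟩ := hb.pair_mem_iff.1 hg
  refine app (trans_app ?_ hy₁ hz (var 4 hm) (var 3 hl')) (var 2 hn)
  exact app (app (var 12 (hl.trans γ g y (hβ.mem hγ) hg hy)) (var 1 hp)) (var 0 hq)

theorem falsNotEps_subset_falsBot (a b : V) : 𝓐.falsNotEps a b ⊆ 𝓐.falsBot := fun _ h => h.1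

/-- Either `y` is `reish γ` for some `γ ∈ β`, or `‖y notε reish β‖` is empty, so that every closed
term realizes `y notε reish β`. -/
theorem notEps_reish_cases {β b : V} (hb : 𝓐.IsReish β b) (y : V) :
    (∃ γ, γ ∊ β ∧ 𝓐.IsReish γ y) ∨ 𝓐.falsNotEps y b = ∅ :=
  or_iff_not_imp_left.2 fun h =>
    Set.eq_empty_of_forall_notMem fun _ hπ => h (hb.pair_mem_iff.1 hπ.2).2

theorem of_eq_empty [he : 𝓐.ClosedEnv e] {t : Tm} {F : Set V} (hF : F = ∅) : 𝓐.Types e t F :=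
  ⟨isClosedTerm_val e t, by simp [hF]⟩

/-- If `y ε reish β`, then `y` is a `reish γ`, and `‖z notε y‖ ⊆ ‖z notε reish β‖`. -/
theorem transEps [he : 𝓐.ClosedEnv e] {β b : V} (hβ : IsOrd β) (hb : 𝓐.IsReish β b) :
    𝓐.Types e (.lam (.lam (.lam (.var 2 ⬩ (.var 1 ⬩ .var 0))))) (𝓐.falsTransEps b) := by
  refine all_intro fun y _ => lam fun u hu _ => all_intro fun z _ => lam fun v hv _ =>
    lam fun w hw _ => app (var 2 hu) ?_
  rcases notEps_reish_cases hb y with ⟨γ, hγ, hy⟩ | h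
  · refine mono (falsNotEps_subset_falsBot _ _) (app (var 1 hv) (mono ?_ (var 0 hw)))
    exact fun π hπ => ⟨hπ.1, hy.mono hβ hb hγ hπ.2⟩
  · exact of_eq_empty h

theorem ordEps [he : 𝓐.ClosedEnv e] {β b : V} (hβ : IsOrd β) (hb : 𝓐.IsReish β b) :
    𝓐.Types e .ordEps (𝓐.falsAnd (𝓐.falsTransEps b)
        (𝓐.allN fun y => 𝓐.arrow (𝓐.falsEps y b) (𝓐.falsTransEps y))) := by
  refine lam fun f hf _ => app (app (var 0 hf) (transEps hβ hb)) ?_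
  refine all_intro fun y _ => lam fun u hu _ => all_intro fun y₁ _ => lam fun u₁ hu₁ _ =>
    all_intro fun z _ => lam fun v hv _ => lam fun w hw _ => app (var 3 hu) ?_
  rcases notEps_reish_cases hb y with ⟨γ, hγ, hy⟩ | h
  · refine mono (falsNotEps_subset_falsBot _ _) (app (var 2 hu₁) ?_)
    rcases notEps_reish_cases hy y₁ with ⟨δ, hδ, hy₁⟩ | h
    · refine mono (falsNotEps_subset_falsBot _ _) (app (var 1 hv) (mono ?_ (var 0 hw)))
      exact fun π hπ => ⟨hπ.1, hy₁.mono (hβ.mem hγ) hy hδ hπ.2⟩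
    · exact of_eq_empty h
  · exact of_eq_empty h

/-- The elements `reish γ` of `reish β` belong to `R`, by the reflexivity of `⊆`. -/
theorem subR [he : 𝓐.ClosedEnv e] (hl : 𝓐.IsLibrary e) {β b c π : V} (hβ : IsOrd β)
    (hb : 𝓐.IsReish β b) (hc : pair c π ∊ b) :
    𝓐.Types e .subR (𝓐.arrow (𝓐.falsNotMemR c) {π}) := by
  obtain ⟨hπ, γ, hγ, hg⟩ := hb.pair_mem_iff.1 hc
  have := isFalsity_singleton hπ
  refine lam fun t ht _ => app (app (notMemR_elim (hβ.mem hγ) hg hπ (var 0 ht)) ?_) ?_ <;>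
    exact var 1 (hl.refl c hg.isName)

/-- If `x` is equal to `reish β` and `y ∈ x`, then `y ∈ reish β`, and `‖y ∉ reish β‖ ⊆ ‖y ∉ R‖`. -/
theorem memR_of_mem [he : 𝓐.ClosedEnv e] (hl : 𝓐.IsLibrary e) :
    𝓐.Types e (.lam (.lam (.lam (.var 2 ⬩ .lam (.lam (.var 3 ⬩ (.var 6 ⬩ .var 1 ⬩ .var 2)))))))
      (𝓐.allN fun x => 𝓐.arrow (𝓐.falsMemR x) <|
        𝓐.allN fun y => 𝓐.arrow (𝓐.falsMem y x) (𝓐.falsMemR y)) := by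
  refine all_intro fun x hx => lam fun u hu _ => all_intro fun y hy => lam fun v hv _ =>
    lam fun w hw _ => app (var 2 hu) (notMemR_intro fun β b π hβ hb _ =>
      lam fun s hs _ => lam fun s' hs' _ => exfalso (app (var 3 hv) ?_))
  exact app (app (var 6 (hl.sub x b y hx hb.isName hy)) (var 1 hs))
    (mono (falsNotMem_subset_falsNotMemR hβ hb hy) (var 2 hw))

/-- `R` is not a set; the ordinal `reish β` is the one provided by `IsLibrary.separating`. -/
theorem exists_notMem [he : 𝓐.ClosedEnv e] (hl : 𝓐.IsLibrary e) :
    𝓐.Types e (.lam (.var 0 ⬩ .lam (.var 0 ⬩ .lam (.var 0) ⬩ .var 6)))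
      (𝓐.allN fun x => 𝓐.arrow (𝓐.allN fun y => 𝓐.arrow (𝓐.falsAnd
        (𝓐.arrow {π | 𝓐.IsStack π ∧ 𝓐.ReishOrd () y π} 𝓐.falsBot) (𝓐.falsNotMem y x))
          𝓐.falsBot) 𝓐.falsBot) := by
  refine all_intro fun x hx => lam fun u hu _ => ?_
  obtain ⟨β, b, hβ, hb, ht⟩ := hl.separating x hx
  refine app (all_elim (F := fun y => 𝓐.arrow (𝓐.falsAnd (𝓐.arrow
    {π | 𝓐.IsStack π ∧ 𝓐.ReishOrd () y π} 𝓐.falsBot) (𝓐.falsNotMem y x)) 𝓐.falsBot)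
    (var 0 hu) hb.isName) (lam fun f hf _ => app (app (var 0 hf) ?_) (var 6 ht))
  exact lam fun z hz _ => mono (G := {π | 𝓐.IsStack π ∧ 𝓐.ReishOrd () b π})
    (fun π (hπ : 𝓐.IsStack π) => ⟨hπ, hπ, β, hβ, hb⟩) (var 0 hz)

end Types

/-! ### Falsity values of formulas -/

variable {C : Type} (I : C → V → V → Prop)

theorem fals_all {m : ℕ} (φ : Fml C (m + 1)) (v : Fin m → V) :
    𝓐.fals I (.all φ) v = 𝓐.allN fun a => 𝓐.fals I φ (Fin.snoc v a) := by
  simp only [fals]; rfl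

theorem fals_imp {m : ℕ} (φ ψ : Fml C m) (v : Fin m → V) :
    𝓐.fals I (.imp φ ψ) v = 𝓐.arrow (𝓐.fals I φ v) (𝓐.fals I ψ v) := by
  simp only [fals]; rfl

theorem fals_bot {m : ℕ} (v : Fin m → V) : 𝓐.fals I .bot v = 𝓐.falsBot := by
  simp only [fals]; rfl

theorem fals_mem {m : ℕ} (x y : Fin m) (v : Fin m → V) :
    𝓐.fals I (.mem x y) v = 𝓐.falsMem (v x) (v y) := by
  simp only [Fml.mem, Fml.neg, fals_imp, fals_bot]; simp only [fals]

theorem fals_eps {m : ℕ} (x y : Fin m) (v : Fin m → V) :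
    𝓐.fals I (.eps x y) v = 𝓐.falsEps (v x) (v y) := by
  simp only [Fml.eps, Fml.neg, fals_imp, fals_bot]; simp only [fals]; rfl

theorem fals_and {m : ℕ} (φ ψ : Fml C m) (v : Fin m → V) :
    𝓐.fals I (.and φ ψ) v = 𝓐.falsAnd (𝓐.fals I φ v) (𝓐.fals I ψ v) := by
  simp only [Fml.and, fals_imp, fals_bot]

theorem fals_ordMem {m : ℕ} (x : Fin m) (v : Fin m → V) :
    𝓐.fals I (.ordMem x) v = 𝓐.falsOrd (v x) := by
  simp only [Fml.ordMem, Fml.memTrans, Fml.allMem, fals_and, fals_all, fals_imp, fals_mem,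
    Fin.snoc_last, Fin.snoc_castSucc]
  rfl

theorem fals_ordEps {m : ℕ} (x : Fin m) (v : Fin m → V) :
    𝓐.fals I (.ordEps x) v = 𝓐.falsAnd (𝓐.falsTransEps (v x))
      (𝓐.allN fun y => 𝓐.arrow (𝓐.falsEps y (v x)) (𝓐.falsTransEps y)) := by
  simp only [Fml.ordEps, Fml.epsTrans, Fml.allEps, fals_and, fals_all, fals_imp, fals_eps,
    Fin.snoc_last, Fin.snoc_castSucc, falsTransEps]

theorem fals_memC {m : ℕ} (x : Fin m) (X : C) (v : Fin m → V) :
    𝓐.fals I (.memC x X) v = 𝓐.arrow (𝓐.falsNotMemC (I X) (v x)) 𝓐.falsBot := by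
  simp only [Fml.memC, Fml.neg, fals_imp, fals_bot]; simp only [fals]

theorem fals_epsC {m : ℕ} (x : Fin m) (X : C) (v : Fin m → V) :
    𝓐.fals I (.epsC x X) v =
      𝓐.arrow {π | 𝓐.IsStack π ∧ I X (v x) π} 𝓐.falsBot := by
  simp only [Fml.epsC, Fml.neg, fals_imp, fals_bot]; simp only [fals]

/-- A bounded quantifier over a class is a union over the names in the class. -/
theorem Types.allC {e : ℕ → V} [he : 𝓐.ClosedEnv e] {t : Tm} {X : C} {φ : Fml C 1}
    (h : ∀ a σ, I X a σ → 𝓐.Types e t (𝓐.fals I φ (Fin.snoc Fin.elim0 a))) :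
    𝓐.Types e t (𝓐.fals I (.allC X φ) Fin.elim0) := by
  refine ⟨isClosedTerm_val e t, fun π hπ => ?_⟩
  simp only [fals] at hπ
  obtain ⟨a, ⟨σ, hσ⟩, hπ⟩ := hπ
  exact (h a σ hσ).2 π hπ

theorem IsLibrary.closedEnv {e : ℕ → V} (hl : 𝓐.IsLibrary e) : 𝓐.ClosedEnv e :=
  ⟨fun i => isClosedTerm_of_isRealizer (hl.realizer i)⟩

theorem IsLibrary.forces {e : ℕ → V} (hl : 𝓐.IsLibrary e) {t : Tm} {φ : Fml C 0} {F : Set V}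
    (h : 𝓐.Types e t F) (hF : 𝓐.fals I φ Fin.elim0 = F) : 𝓐.Forces I φ :=
  ⟨_, t.isRealizer_val hl.realizer, h.mono hF.subset⟩

end RealizabilityAlgebra

end Krivine

open Krivine Krivine.Fml in
theorem mainTheorem1 {V : Type*} [setLang.Structure V] [ModelZF V] (𝓐 : RealizabilityAlgebra V) :
    -- every extensional ordinal belongs to the class, and conversely
    𝓐.Forces 𝓐.ReishOrd (all (imp (ordMem 0) (memC 0 rOrd))) ∧
    𝓐.Forces 𝓐.ReishOrd (all (imp (memC 0 rOrd) (ordMem 0))) ∧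
    -- the elements of the class are `ε`-ordinals
    𝓐.Forces 𝓐.ReishOrd (allC rOrd (ordEps 0)) ∧
    -- the class is closed under initial segments
    𝓐.Forces 𝓐.ReishOrd (allC rOrd (subC 0 rOrd)) ∧
    𝓐.Forces 𝓐.ReishOrd (all (imp (memC 0 rOrd) (all (imp (mem 1 0) (memC 1 rOrd))))) ∧
    -- the class is a proper class: `∀ x, ∃ y, (y ε X ∧ y ∉ x)`
    𝓐.Forces 𝓐.ReishOrd (all (ex (and (epsC 1 rOrd) (notMem 1 0)))) ∧
    -- one realizer shows, for every name `a`, that some `reish β` is not in `a`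
    (∃ t, 𝓐.IsRealizer t ∧ ∀ a, 𝓐.IsName a →
      ∃ β b, IsOrd β ∧ 𝓐.IsReish β b ∧ 𝓐.Realizes 𝓐.ReishOrd t (notMem 0 1) ![b, a]) := by
  obtain ⟨e, hl⟩ := RealizabilityAlgebra.exists_isLibrary (𝓐 := 𝓐)
  have := hl.closedEnv
  refine ⟨?_, ?_, ?_, ?_, ?_, ?_, e 4, hl.realizer 4, fun a ha => ?_⟩
  · refine hl.forces _ (RealizabilityAlgebra.Types.memR_of_ord hl) ?_
    simp only [RealizabilityAlgebra.fals_all, RealizabilityAlgebra.fals_imp,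
      RealizabilityAlgebra.fals_ordMem, RealizabilityAlgebra.fals_memC]
    rfl
  · refine hl.forces _ (RealizabilityAlgebra.Types.ord_of_memR hl) ?_
    simp only [RealizabilityAlgebra.fals_all, RealizabilityAlgebra.fals_imp,
      RealizabilityAlgebra.fals_ordMem, RealizabilityAlgebra.fals_memC]
    rfl
  · refine hl.forces _ (RealizabilityAlgebra.Types.allC _ (t := .ordEps) fun b σ hb => ?_) rfl
    obtain ⟨-, β, hβ, hb⟩ := hb
    rw [RealizabilityAlgebra.fals_ordEps]
    exact RealizabilityAlgebra.Types.ordEps hβ hb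
  · refine hl.forces _ (RealizabilityAlgebra.Types.allC _ fun b σ hb =>
      ⟨RealizabilityAlgebra.isClosedTerm_val e .subR, ?_⟩) rfl
    obtain ⟨-, β, hβ, hb⟩ := hb
    simp only [RealizabilityAlgebra.fals]
    rintro _ ⟨c, t, π, hc, ht, rfl⟩
    exact (RealizabilityAlgebra.Types.subR hl hβ hb hc).2 _ ⟨t, π, ht, rfl, rfl⟩
  · refine hl.forces _ (RealizabilityAlgebra.Types.memR_of_mem hl) ?_
    simp only [RealizabilityAlgebra.fals_all, RealizabilityAlgebra.fals_imp,
      RealizabilityAlgebra.fals_mem, RealizabilityAlgebra.fals_memC]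
    rfl
  · refine hl.forces _ (RealizabilityAlgebra.Types.exists_notMem hl) ?_
    simp only [Fml.ex, RealizabilityAlgebra.fals_all, RealizabilityAlgebra.fals_imp,
      RealizabilityAlgebra.fals_bot, RealizabilityAlgebra.fals_and,
      RealizabilityAlgebra.fals_epsC]
    simp only [RealizabilityAlgebra.fals]
    rfl
  · obtain ⟨β, b, hβ, hb, ht⟩ := hl.separating a ha
    refine ⟨β, b, hβ, hb, ?_⟩
    simp only [RealizabilityAlgebra.Realizes, RealizabilityAlgebra.fals]
    exact ht
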